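/- Let $H$ be an infinite-dimensional separable complex Hilbert space, with inner product $\langle\cdot,\cdot\rangle$ linear in the first argument, and let $A$ be a (densely defined, unbounded) self-adjoint operator in $H$ with simple discrete spectrum; that is, $A$ has compact resolvent and all its eigenspaces are one-dimensional. Let $\lambda_n$, $n\in I$, be an enumeration of the (real) eigenvalues of $A$ without repetitions (e.g. with $I=\mathbb N$ or $I=\mathbb Z$), and assume that they are uniformly separated: there is $d>0$ with $|\lambda_m-\lambda_n|\ge d$ for all $m\ne n$. For nonzero $\varphi,\psi\in H$ let $B=A+\langle\cdot,\varphi\rangle\psi$, with $\operatorname{dom}B=\operatorname{dom}A$. The geometric multiplicity of $z$ for $B$ is $\dim\ker(B-z)$ and its algebraic multiplicity is the dimension of the root subspace $\bigcup_{k}\ker(B-z)^k$. Then, for all nonzero $\varphi,\psi\in H$: (i) for every $\varepsilon>0$ there is $r$ such that every eigenvalue $z$ of $B$ with $|z|>r$ satisfies $|z-\lambda_n|<\varepsilon$ for some $n\in I$ and is simple, i.e. has algebraic multiplicity $1$; (ii) the eigenvalues of $B$, each repeated according to its algebraic multiplicity, can be enumerated as $\mu_n$, $n\in I$, so that $\mu_n-\lambda_n\to0$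 (for every $\delta>0$, $|\mu_n-\lambda_n|<\delta$ for all but finitely many $n\in I$; for $I=\mathbb N$ or $I=\mathbb Z$ this is the limit as $|n|\to\infty$); (iii) every eigenvalue $z$ of $B$ has geometric multiplicity at most $2$; and if it has geometric multiplicity $2$, then $z$ is an eigenvalue of $A$ and the eigenspace $\ker(A-z)$ of $A$ is a reducing subspace for $B$. Moreover, for every finite set of pairwise distinct complex numbers $z_1,\dots,z_k$ and all positive integers $m_1,\dots,m_k$, there are nonzero $\varphi,\psi\in H$ such that each $z_j$ is an eigenvalue of $B=A+\langle\cdot,\varphi\rangle\psi$ of algebraic multiplicity $m_j$. -/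

import Mathlib

namespace RankOnePerturbation

noncomputable section

/-- The rank-one perturbation `B = A + ⟨·, φ⟩ ψ` of an unbounded operator `A`, with the same domain
as `A`. Mathlib's inner product is linear in the second variable, so that the number written
`⟨x, φ⟩` here is `inner ℂ φ x`, and `B x = A x + inner ℂ φ x • ψ`. -/
def perturb {H : Type*} [NormedAddCommGroup H] [InnerProductSpace ℂ H]
    (A : H →ₗ.[ℂ] H) (φ ψ : H) : H →ₗ.[ℂ] H where
  domain := A.domain
  toFun := A.toFun +
    (InnerProductSpace.rankOne ℂ ψ φ : H →L[ℂ] H).toLinearMap.comp A.domain.subtype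

/-- The operator `T - z` as a linear map on the domain of `T`. -/
def shift {H : Type*} [NormedAddCommGroup H] [InnerProductSpace ℂ H]
    (T : H →ₗ.[ℂ] H) (z : ℂ) : T.domain →ₗ[ℂ] H :=
  T.toFun - z • T.domain.subtype

/-- The eigenspace `ker (T - z)`, as a subspace of `H`. -/
def eigenspace {H : Type*} [NormedAddCommGroup H] [InnerProductSpace ℂ H]
    (T : H →ₗ.[ℂ] H) (z : ℂ) : Submodule ℂ H :=
  (LinearMap.ker (shift T z)).map T.domain.subtype

/-- `z` is an eigenvalue of `T`. -/
def IsEigenvalue {H : Type*} [NormedAddCommGroup H] [InnerProductSpace ℂ H]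
    (T : H →ₗ.[ℂ] H) (z : ℂ) : Prop :=
  eigenspace T z ≠ ⊥

/-- The subspace `ker (T - z) ^ k` of `H`, where the powers carry their natural domains:
`x ∈ ker (T - z) ^ (k + 1)` means that `x` is in the domain of `T` and
`(T - z) x ∈ ker (T - z) ^ k`. -/
def kerPow {H : Type*} [NormedAddCommGroup H] [InnerProductSpace ℂ H]
    (T : H →ₗ.[ℂ] H) (z : ℂ) : ℕ → Submodule ℂ H
  | 0 => ⊥
  | k + 1 => ((kerPow T z k).comap (shift T z)).map T.domain.subtype

/-- The root subspace `⋃ k, ker (T - z) ^ k` (an increasing union). -/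
def rootSubspace {H : Type*} [NormedAddCommGroup H] [InnerProductSpace ℂ H]
    (T : H →ₗ.[ℂ] H) (z : ℂ) : Submodule ℂ H :=
  ⨆ k : ℕ, kerPow T z k

/-- The geometric multiplicity: the dimension of the eigenspace, in `ℕ ∪ {∞}`. -/
def geomMult {H : Type*} [NormedAddCommGroup H] [InnerProductSpace ℂ H]
    (T : H →ₗ.[ℂ] H) (z : ℂ) : ℕ∞ :=
  Cardinal.toENat (Module.rank ℂ (eigenspace T z))

/-- The algebraic multiplicity: the dimension of the root subspace, in `ℕ ∪ {∞}`
(it is `0` if `z` is not an eigenvalue). -/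
def algMult {H : Type*} [NormedAddCommGroup H] [InnerProductSpace ℂ H]
    (T : H →ₗ.[ℂ] H) (z : ℂ) : ℕ∞ :=
  Cardinal.toENat (Module.rank ℂ (rootSubspace T z))

/-- The bounded operator `R` is the resolvent `(T - z)⁻¹`; in particular, `z` is in the resolvent
set of `T`. -/
def IsResolvent {H : Type*} [NormedAddCommGroup H] [InnerProductSpace ℂ H]
    (T : H →ₗ.[ℂ] H) (z : ℂ) (R : H →L[ℂ] H) : Prop :=
  (∀ y : H, ∃ x : T.domain, (x : H) = R y ∧ shift T z x = y) ∧
    ∀ x : T.domain, R (shift T z x) = x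

/-- `T` has discrete spectrum: its resolvent is compact. -/
def HasDiscreteSpectrum {H : Type*} [NormedAddCommGroup H] [InnerProductSpace ℂ H]
    (T : H →ₗ.[ℂ] H) : Prop :=
  ∃ (z : ℂ) (R : H →L[ℂ] H), IsResolvent T z R ∧ IsCompactOperator R

/-- `A` is self-adjoint (in particular densely defined) and has simple discrete spectrum. -/
structure IsSelfAdjointSimpleDiscrete {H : Type*} [NormedAddCommGroup H] [InnerProductSpace ℂ H]
    [CompleteSpace H] (A : H →ₗ.[ℂ] H) : Prop where
  selfAdjoint : IsSelfAdjoint A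
  discrete : HasDiscreteSpectrum A
  simple : ∀ z : ℂ, IsEigenvalue A z → geomMult A z = 1

/-- The family `lam` of real numbers lists the eigenvalues of `A`, each exactly once. -/
structure EnumeratesEigenvalues {H : Type*} [NormedAddCommGroup H] [InnerProductSpace ℂ H]
    {I : Type*} (A : H →ₗ.[ℂ] H) (lam : I → ℝ) : Prop where
  injective : Function.Injective lam
  isEigenvalue_iff : ∀ z : ℂ, IsEigenvalue A z ↔ ∃ n : I, z = (lam n : ℂ)

/-- The closed subspace `M` reduces `T`: every `x` in the domain of `T` is `u + v` with `u ∈ M`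
and `v ∈ Mᗮ` in the domain of `T`, and `T u ∈ M`, `T v ∈ Mᗮ`. Equivalently, the orthogonal
projector `P` onto `M` maps the domain of `T` into itself and `T P x = P T x` there. -/
def Reduces {H : Type*} [NormedAddCommGroup H] [InnerProductSpace ℂ H]
    (M : Submodule ℂ H) (T : H →ₗ.[ℂ] H) : Prop :=
  IsClosed (M : Set H) ∧
    ∀ x : T.domain, ∃ u v : T.domain, x = u + v ∧
      (u : H) ∈ M ∧ (v : H) ∈ Mᗮ ∧ T u ∈ M ∧ T v ∈ Mᗮ

end

end RankOnePerturbation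

open scoped InnerProductSpace

namespace RankOnePerturbation

section Diagonalization

variable {H : Type*} [NormedAddCommGroup H] [InnerProductSpace ℂ H]

theorem mem_eigenspace_iff {T : H →ₗ.[ℂ] H} {z : ℂ} {x : H} :
    x ∈ eigenspace T z ↔ ∃ u : T.domain, (u : H) = x ∧ T u = z • x := by
  simp only [eigenspace, Submodule.mem_map, LinearMap.mem_ker]
  constructor
  · rintro ⟨u, hu, rfl⟩
    exact ⟨u, rfl, sub_eq_zero.1 hu⟩
  · rintro ⟨u, rfl, hu⟩
    exact ⟨u, sub_eq_zero.2 hu, rfl⟩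

theorem isEigenvalue_iff {T : H →ₗ.[ℂ] H} {z : ℂ} :
    IsEigenvalue T z ↔ ∃ u : T.domain, (u : H) ≠ 0 ∧ T u = z • (u : H) := by
  rw [IsEigenvalue, Submodule.ne_bot_iff]
  constructor
  · rintro ⟨x, hx, h0⟩
    obtain ⟨u, rfl, hu⟩ := mem_eigenspace_iff.1 hx
    exact ⟨u, h0, hu⟩
  · rintro ⟨u, h0, hu⟩
    exact ⟨u, mem_eigenspace_iff.2 ⟨u, rfl, hu⟩, h0⟩

theorem hilbertBasis_ext {I : Type*} (e : HilbertBasis I ℂ H) {x y : H}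
    (h : ∀ n, ⟪e n, x⟫_ℂ = ⟪e n, y⟫_ℂ) : x = y := by
  apply e.repr.injective
  ext n
  rw [e.repr_apply_apply, e.repr_apply_apply, h]

variable [CompleteSpace H]

theorem inner_apply_left_of_isSelfAdjoint {A : H →ₗ.[ℂ] H} (hA : IsSelfAdjoint A)
    (x y : A.domain) : ⟪A x, (y : H)⟫_ℂ = ⟪(x : H), A y⟫_ℂ := by
  have h := LinearPMap.adjoint_isFormalAdjoint hA.dense_domain
  rw [LinearPMap.isSelfAdjoint_def.1 hA] at h
  exact h x y

/-- A real number which is not an eigenvalue of a self-adjoint operator with discrete spectrum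
is in its resolvent set, and the resolvent is compact and symmetric. -/
theorem exists_compact_symmetric_resolvent {A : H →ₗ.[ℂ] H} (hA : IsSelfAdjoint A)
    (hd : HasDiscreteSpectrum A) {w : ℝ} (hw : ¬ IsEigenvalue A w) :
    ∃ K : H →L[ℂ] H, IsCompactOperator K ∧ (K : H →ₗ[ℂ] H).IsSymmetric ∧
      ∀ y, ∃ x : A.domain, (x : H) = K y ∧ A x = y + (w : ℂ) • (x : H) := by
  suffices h : ∃ K : H →L[ℂ] H, IsCompactOperator K ∧
      ∀ y, ∃ x : A.domain, (x : H) = K y ∧ A x = y + (w : ℂ) • (x : H) by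
    obtain ⟨K, hK, h⟩ := h
    refine ⟨K, hK, fun x y => ?_, h⟩
    obtain ⟨u, hu, hu'⟩ := h x
    obtain ⟨v, hv, hv'⟩ := h y
    have := inner_apply_left_of_isSelfAdjoint hA u v
    rw [hu', hv', inner_add_left, inner_add_right, inner_smul_left, inner_smul_right,
      Complex.conj_ofReal] at this
    simp only [ContinuousLinearMap.coe_coe]
    rw [← hu, ← hv]
    exact (add_right_cancel this).symm
  obtain ⟨z, R, ⟨hR, hR'⟩, hc⟩ := hd
  by_cases hwz : (w : ℂ) = z
  · refine ⟨R, hc, fun y => ?_⟩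
    obtain ⟨x, hx, hxy⟩ := hR y
    refine ⟨x, hx, ?_⟩
    rw [← hxy, hwz]
    simp [shift]
  have hwz' : (w : ℂ) - z ≠ 0 := sub_ne_zero.2 hwz
  have hμ : ((w : ℂ) - z)⁻¹ ≠ 0 := inv_ne_zero hwz'
  rcases hc.hasEigenvalue_or_mem_resolventSet hμ with h | h
  · exfalso
    apply hw
    obtain ⟨x, hx, hx0⟩ := h.exists_hasEigenvector
    rw [Module.End.mem_eigenspace_iff] at hx
    obtain ⟨u, hu, hux⟩ := hR x
    have hu2 : (u : H) = ((w : ℂ) - z)⁻¹ • x := hu.trans hx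
    have hx2 : x = ((w : ℂ) - z) • (u : H) := by rw [hu2, smul_inv_smul₀ hwz']
    refine isEigenvalue_iff.2 ⟨u, fun h0 => hx0 (by rw [hx2, h0, smul_zero]), ?_⟩
    have h3 : A u - z • (u : H) = ((w : ℂ) - z) • (u : H) := hux.trans hx2
    rw [sub_eq_iff_eq_add] at h3
    rw [h3]; module
  · rw [spectrum.mem_resolventSet_iff] at h
    obtain ⟨V, hV, hV'⟩ := isUnit_iff_exists.1 h
    refine ⟨((w : ℂ) - z)⁻¹ • (R.comp V), (hc.comp_clm V).smul _, fun y => ?_⟩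
    obtain ⟨x, hx, hxy⟩ := hR (V y)
    have h1 : ((w : ℂ) - z)⁻¹ • V y - R (V y) = y := by
      have := congrArg (fun T : H →L[ℂ] H => T y) hV
      simpa [Algebra.algebraMap_eq_smul_one] using this
    have h2 : A x - z • (x : H) = V y := hxy
    refine ⟨((w : ℂ) - z)⁻¹ • x, by simp [hx], ?_⟩
    rw [LinearPMap.map_smul, sub_eq_iff_eq_add.1 h2]
    nth_rw 2 [← h1]
    simp only [Submodule.coe_smul, ← hx]
    have : (x : H) = (((w : ℂ) - z)⁻¹ * ((w : ℂ) - z)) • (x : H) := by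
      rw [inv_mul_cancel₀ hwz', one_smul]
    nth_rw 2 [this]
    module

/-- In the basis `e` the operator `A` is the maximal multiplication operator by `lam`. -/
def IsDiagonal {I : Type*} (A : H →ₗ.[ℂ] H) (e : HilbertBasis I ℂ H) (lam : I → ℝ) : Prop :=
  ∀ x y : H, (∃ u : A.domain, (u : H) = x ∧ A u = y) ↔
    ∀ n, ⟪e n, y⟫_ℂ = (lam n : ℂ) * ⟪e n, x⟫_ℂ

theorem exists_hilbertBasis_isDiagonal {A : H →ₗ.[ℂ] H} (hA : IsSelfAdjointSimpleDiscrete A)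
    {I : Type*} {lam : I → ℝ} (hlam : EnumeratesEigenvalues A lam)
    (hsep : ∃ d : ℝ, 0 < d ∧ ∀ m n : I, m ≠ n → d ≤ |lam m - lam n|) :
    ∃ e : HilbertBasis I ℂ H, IsDiagonal A e lam := by
  obtain ⟨w, hw⟩ : ∃ w : ℝ, ∀ n, lam n ≠ w := by
    by_contra! hcon
    obtain ⟨d, hd, hsep⟩ := hsep
    obtain ⟨m, hm⟩ := hcon 0
    obtain ⟨n, hn⟩ := hcon (d / 2)
    have := hsep m n (by rintro rfl; linarith)
    rw [hm, hn, zero_sub, abs_neg, abs_of_pos (by linarith)] at this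
    linarith
  have hw' : ¬ IsEigenvalue A w := fun h => by
    obtain ⟨n, hn⟩ := (hlam.isEigenvalue_iff _).1 h
    exact hw n (by exact_mod_cast hn.symm)
  obtain ⟨K, hKc, hKs, hK⟩ := exists_compact_symmetric_resolvent hA.selfAdjoint hA.discrete hw'
  have hv : ∀ n, ∃ u : A.domain, ‖(u : H)‖ = 1 ∧ A u = (lam n : ℂ) • (u : H) := fun n => by
    obtain ⟨u, hu, hu'⟩ := isEigenvalue_iff.1 ((hlam.isEigenvalue_iff _).2 ⟨n, rfl⟩)
    refine ⟨((‖(u : H)‖⁻¹ : ℝ) : ℂ) • u, ?_, ?_⟩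
    · rw [Submodule.coe_smul, norm_smul]
      simp [norm_ne_zero_iff.2 hu]
    · rw [LinearPMap.map_smul, hu', Submodule.coe_smul, smul_comm]
  choose v hv1 hv2 using hv
  have hsym := inner_apply_left_of_isSelfAdjoint hA.selfAdjoint
  have hcoord : ∀ (n : I) (x : A.domain),
      ⟪(v n : H), A x⟫_ℂ = (lam n : ℂ) * ⟪(v n : H), (x : H)⟫_ℂ := fun n x => by
    rw [← hsym, hv2, inner_smul_left, Complex.conj_ofReal]
  have hon : Orthonormal ℂ (fun n => (v n : H)) := by
    refine ⟨hv1, fun m n hmn => ?_⟩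
    have h := hcoord m (v n)
    rw [hv2, inner_smul_right] at h
    have h2 : (lam n : ℂ) - lam m ≠ 0 :=
      sub_ne_zero.2 fun h => hmn (hlam.injective (by exact_mod_cast h.symm))
    refine (mul_eq_zero.1 (?_ : ((lam n : ℂ) - lam m) * _ = 0)).resolve_left h2
    rw [sub_mul, h, sub_self]
  have htop : (Submodule.span ℂ (Set.range fun n => (v n : H)))ᗮ = ⊥ := by
    have h := ContinuousLinearMap.orthogonalComplement_iSup_eigenspaces_eq_bot hKc hKs
    refine eq_bot_iff.2 (h ▸ Submodule.orthogonal_le (iSup_le fun μ x hx => ?_))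
    rw [Module.End.mem_eigenspace_iff] at hx
    obtain ⟨u, hu, hu'⟩ := hK x
    by_cases hx0 : x = 0
    · rw [hx0]; exact zero_mem _
    have hx1 : K x = μ • x := hx
    have hμ : μ ≠ 0 := by
      rintro rfl
      rw [hx1, zero_smul] at hu
      have : u = 0 := Subtype.ext hu
      rw [this, LinearPMap.map_zero] at hu'
      simp at hu'
      exact hx0 hu'.symm
    have hu2 : (u : H) = μ • x := hu.trans hx1
    have hx2 : x = μ⁻¹ • (u : H) := by rw [hu2, inv_smul_smul₀ hμ]
    have hu0 : (u : H) ≠ 0 := by rw [hu2]; exact smul_ne_zero hμ hx0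
    have hAu : A u = (μ⁻¹ + w) • (u : H) := by
      rw [hu', add_smul, ← hx2]
    obtain ⟨n, hn⟩ := (hlam.isEigenvalue_iff _).1 (isEigenvalue_iff.2 ⟨u, hu0, hAu⟩)
    have hg := hA.simple _ ((hlam.isEigenvalue_iff _).2 ⟨n, rfl⟩)
    rw [geomMult, Cardinal.toENat_eq_one, Module.rank_eq_one_iff_finrank_eq_one] at hg
    have hvn : (v n : H) ∈ eigenspace A (lam n) := mem_eigenspace_iff.2 ⟨v n, rfl, hv2 n⟩
    have hun : (u : H) ∈ eigenspace A (lam n) :=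
      mem_eigenspace_iff.2 ⟨u, rfl, by rw [hAu, hn]⟩
    have hvn0 : (⟨v n, hvn⟩ : eigenspace A (lam n)) ≠ 0 := fun h => by
      have h1 := hv1 n
      rw [show (v n : H) = 0 from congrArg Subtype.val h] at h1
      simp at h1
    obtain ⟨c, hc⟩ := (finrank_eq_one_iff_of_nonzero' _ hvn0).1 hg ⟨u, hun⟩
    have hc' : c • (v n : H) = u := congrArg Subtype.val hc
    rw [hx2, ← hc']
    exact Submodule.smul_mem _ _ (Submodule.smul_mem _ _ (Submodule.subset_span ⟨n, rfl⟩))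
  let e := HilbertBasis.mkOfOrthogonalEqBot hon htop
  have he : ∀ n, e n = v n := fun n => by
    simp [e]
  refine ⟨e, fun x y => ⟨?_, fun h => ?_⟩⟩
  · rintro ⟨u, rfl, rfl⟩ n
    rw [he]; exact hcoord n u
  · obtain ⟨u, -, hu⟩ := hK (y - (w : ℂ) • x)
    have hux : (u : H) = x := by
      refine hilbertBasis_ext e fun n => ?_
      have h1 := hcoord n u
      rw [hu, ← he, inner_add_right, inner_sub_right, inner_smul_right, inner_smul_right, h n] at h1
      have h2 : (lam n : ℂ) - w ≠ 0 := sub_ne_zero.2 (by exact_mod_cast hw n)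
      apply mul_left_cancel₀ h2
      linear_combination -h1
    refine ⟨u, hux, ?_⟩
    rw [hu, hux]; abel

end Diagonalization

section Relation

variable {H : Type*} [NormedAddCommGroup H] [InnerProductSpace ℂ H]

variable {I : Type*} {A : H →ₗ.[ℂ] H} {e : HilbertBasis I ℂ H} {lam : I → ℝ} {φ ψ : H} {z : ℂ}

/-- The relation `(A + ⟨·, φ⟩ ψ - z) x = y`, in the coordinates of an eigenbasis of `A`. -/
def ShiftRel (e : HilbertBasis I ℂ H) (lam : I → ℝ) (φ ψ : H) (z : ℂ) (x y : H) : Prop :=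
  ∀ n, ((lam n : ℂ) - z) * ⟪e n, x⟫_ℂ + ⟪φ, x⟫_ℂ * ⟪e n, ψ⟫_ℂ = ⟪e n, y⟫_ℂ

theorem perturb_apply (u : (perturb A φ ψ).domain) :
    perturb A φ ψ u = A u + ⟪φ, (u : H)⟫_ℂ • ψ := rfl

theorem shift_perturb_apply (u : (perturb A φ ψ).domain) :
    shift (perturb A φ ψ) z u = A u + ⟪φ, (u : H)⟫_ℂ • ψ - z • (u : H) := rfl

theorem IsDiagonal.shiftRel_iff (hA : IsDiagonal A e lam) {x y : H} :
    ShiftRel e lam φ ψ z x y ↔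
      ∃ u : (perturb A φ ψ).domain, (u : H) = x ∧ shift (perturb A φ ψ) z u = y := by
  have h := hA x (y - ⟪φ, x⟫_ℂ • ψ + z • x)
  constructor
  · intro hr
    obtain ⟨u, hu, hu'⟩ := h.2 fun n => by
      rw [inner_add_right, inner_sub_right, inner_smul_right, inner_smul_right, ← hr n]
      ring
    refine ⟨u, hu, (shift_perturb_apply u).trans ?_⟩
    rw [hu', hu]
    abel
  · rintro ⟨u, hu, hu'⟩ n
    rw [shift_perturb_apply] at hu'
    have h2 := h.1 ⟨u, hu, by rw [← hu', hu]; abel⟩ n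
    rw [inner_add_right, inner_sub_right, inner_smul_right, inner_smul_right] at h2
    linear_combination -h2

theorem IsDiagonal.mem_kerPow_succ_iff (hA : IsDiagonal A e lam) {k : ℕ} {x : H} :
    x ∈ kerPow (perturb A φ ψ) z (k + 1) ↔
      ∃ y ∈ kerPow (perturb A φ ψ) z k, ShiftRel e lam φ ψ z x y := by
  simp only [kerPow, Submodule.mem_map, Submodule.mem_comap, hA.shiftRel_iff]
  constructor
  · rintro ⟨u, hu, rfl⟩
    exact ⟨_, hu, u, rfl, rfl⟩
  · rintro ⟨_, hy, u, rfl, rfl⟩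
    exact ⟨u, hy, rfl⟩

theorem IsDiagonal.mem_eigenspace_perturb_iff (hA : IsDiagonal A e lam) {x : H} :
    x ∈ eigenspace (perturb A φ ψ) z ↔ ShiftRel e lam φ ψ z x 0 := by
  simp only [eigenspace, Submodule.mem_map, LinearMap.mem_ker, hA.shiftRel_iff]
  exact ⟨fun ⟨u, hu, hx⟩ => ⟨u, hx, hu⟩, fun ⟨u, hx, hu⟩ => ⟨u, hu, hx⟩⟩

theorem IsDiagonal.mem_eigenspace_iff (hA : IsDiagonal A e lam) {x : H} :
    x ∈ eigenspace A z ↔ ∀ n, (lam n : ℂ) * ⟪e n, x⟫_ℂ = z * ⟪e n, x⟫_ℂ := by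
  rw [RankOnePerturbation.mem_eigenspace_iff]
  have : (∃ u : A.domain, (u : H) = x ∧ A u = z • x) ↔
      ∀ n, ⟪e n, z • x⟫_ℂ = (lam n : ℂ) * ⟪e n, x⟫_ℂ := hA x (z • x)
  rw [this]
  simp only [inner_smul_right, eq_comm]

theorem inner_basis [DecidableEq I] (e : HilbertBasis I ℂ H) (m n : I) :
    ⟪e m, e n⟫_ℂ = if m = n then 1 else 0 :=
  orthonormal_iff_ite.1 e.orthonormal m n

theorem ShiftRel.zero_right_eq_zero (hz : ∀ n, (lam n : ℂ) ≠ z) {x : H}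
    (hx : ShiftRel e lam φ ψ z x 0) (hφ : ⟪φ, x⟫_ℂ = 0) : x = 0 := by
  refine hilbertBasis_ext e fun n => ?_
  have h := hx n
  rw [hφ, zero_mul, add_zero, inner_zero_right] at h
  rw [inner_zero_right]
  exact (mul_eq_zero.1 h).resolve_left (sub_ne_zero.2 (hz n))

theorem ShiftRel.zero_right_eq_zero_of_inner_eq_zero (hlam : Function.Injective lam) {p : I}
    {x : H} (hx : ShiftRel e lam φ ψ (lam p) x 0) (hp : ⟪e p, x⟫_ℂ = 0) (hφ : ⟪φ, x⟫_ℂ = 0) :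
    x = 0 := by
  refine hilbertBasis_ext e fun n => ?_
  by_cases hn : n = p
  · rw [hn, hp, inner_zero_right]
  have h := hx n
  rw [hφ, zero_mul, add_zero, inner_zero_right] at h
  rw [inner_zero_right]
  exact (mul_eq_zero.1 h).resolve_left
    (sub_ne_zero.2 fun h => hn (hlam (by exact_mod_cast h)))

theorem rank_le_of_injective_pi {k : ℕ} (M : Submodule ℂ H) (f : H →ₗ[ℂ] (Fin k → ℂ))
    (hf : ∀ x ∈ M, f x = 0 → x = 0) : Module.rank ℂ M ≤ k := by
  have hinj : Function.Injective (f.domRestrict M) := by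
    rw [← LinearMap.ker_eq_bot, LinearMap.ker_eq_bot']
    exact fun x hx => Subtype.ext (hf x x.2 hx)
  simpa using LinearMap.lift_rank_le_of_injective (f.domRestrict M) hinj

theorem IsDiagonal.geomMult_perturb (hA : IsDiagonal A e lam) (hlam : Function.Injective lam) :
    geomMult (perturb A φ ψ) z ≤ 2 ∧ (geomMult (perturb A φ ψ) z = 2 →
      IsEigenvalue A z ∧ Reduces (eigenspace A z) (perturb A φ ψ)) := by
  classical
  by_cases hz : ∀ n, (lam n : ℂ) ≠ z
  · have h1 : Module.rank ℂ (eigenspace (perturb A φ ψ) z) ≤ (1 : ℕ) := by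
      refine rank_le_of_injective_pi _ (LinearMap.pi fun _ => (innerSL ℂ φ).toLinearMap) ?_
      intro x hx h0
      exact (hA.mem_eigenspace_perturb_iff.1 hx).zero_right_eq_zero hz (congrFun h0 0)
    have h2 : geomMult (perturb A φ ψ) z ≤ 1 := by
      simpa [geomMult] using Cardinal.toENat.monotone' h1
    refine ⟨h2.trans (by norm_num), fun h => ?_⟩
    rw [h] at h2
    norm_num at h2
  push Not at hz
  obtain ⟨p, rfl⟩ := hz
  let f : H →ₗ[ℂ] (Fin 2 → ℂ) :=
    LinearMap.pi ![(innerSL ℂ (e p)).toLinearMap, (innerSL ℂ φ).toLinearMap]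
  have hf : ∀ x ∈ eigenspace (perturb A φ ψ) (lam p), f x = 0 → x = 0 := fun x hx h0 =>
    (hA.mem_eigenspace_perturb_iff.1 hx).zero_right_eq_zero_of_inner_eq_zero hlam
      (congrFun h0 0) (congrFun h0 1)
  have hrank := rank_le_of_injective_pi _ f hf
  refine ⟨by simpa [geomMult] using Cardinal.toENat.monotone' hrank, fun h => ?_⟩
  have hfin : Module.finrank ℂ (eigenspace (perturb A φ ψ) (lam p)) = 2 := by
    rw [Module.finrank, ← Cardinal.toNat_toENat]
    rw [geomMult] at h
    rw [h]; rfl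
  have hinj : Function.Injective (f.domRestrict (eigenspace (perturb A φ ψ) (lam p))) := by
    rw [← LinearMap.ker_eq_bot, LinearMap.ker_eq_bot']
    exact fun x hx => Subtype.ext (hf x x.2 hx)
  have hfd : FiniteDimensional ℂ (eigenspace (perturb A φ ψ) (lam p)) :=
    Module.finite_of_finrank_pos (by omega)
  have hsurj : Function.Surjective (f.domRestrict (eigenspace (perturb A φ ψ) (lam p))) :=
    (LinearMap.injective_iff_surjective_of_finrank_eq_finrank (by simp [hfin])).1 hinj
  have hsur : ∀ a b : ℂ, ∃ x, ShiftRel e lam φ ψ (lam p) x 0 ∧ ⟪e p, x⟫_ℂ = a ∧ ⟪φ, x⟫_ℂ = b :=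
    fun a b => by
      obtain ⟨x, hx⟩ := hsurj ![a, b]
      exact ⟨x, hA.mem_eigenspace_perturb_iff.1 x.2, congrFun hx 0, congrFun hx 1⟩
  have hψp : ⟪e p, ψ⟫_ℂ = 0 := by
    obtain ⟨x, hx, -, hb⟩ := hsur 0 1
    simpa [hb] using hx p
  have hφp : ⟪φ, e p⟫_ℂ = 0 := by
    obtain ⟨x, hx, ha, hb⟩ := hsur 1 0
    have : x = e p := by
      refine hilbertBasis_ext e fun n => ?_
      by_cases hn : n = p
      · rw [hn, ha, inner_basis, if_pos rfl]
      have h := hx n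
      rw [hb, zero_mul, add_zero, inner_zero_right] at h
      rw [inner_basis, if_neg hn]
      exact (mul_eq_zero.1 h).resolve_left
        (sub_ne_zero.2 fun h => hn (hlam (by exact_mod_cast h)))
    rw [← this, hb]
  have hmem : ∀ x, x ∈ eigenspace A (lam p) ↔ ∃ c : ℂ, x = c • e p := fun x => by
    rw [hA.mem_eigenspace_iff]
    constructor
    · intro h
      refine ⟨⟪e p, x⟫_ℂ, hilbertBasis_ext e fun n => ?_⟩
      rw [inner_smul_right, inner_basis]
      by_cases hn : n = p
      · simp [hn]
      rw [if_neg hn, mul_zero]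
      by_contra h0
      exact hn (hlam (by exact_mod_cast mul_right_cancel₀ h0 (h n)))
    · rintro ⟨c, rfl⟩ n
      rw [inner_smul_right, inner_basis]
      by_cases hn : n = p <;> simp [hn]
  have hspan : eigenspace A (lam p) = Submodule.span ℂ {e p} := by
    ext x
    rw [hmem, Submodule.mem_span_singleton]
    simp only [eq_comm]
  have hep : e p ∈ eigenspace A (lam p) := (hmem _).2 ⟨1, (one_smul _ _).symm⟩
  have hep0 : e p ≠ 0 := e.orthonormal.ne_zero p
  refine ⟨fun h => hep0 (by simpa [h] using hep), ?_, fun x => ?_⟩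
  · rw [hspan]; exact Submodule.closed_of_finiteDimensional _
  · obtain ⟨v0, hv0, hv0'⟩ := RankOnePerturbation.mem_eigenspace_iff.1 hep
    let u : (perturb A φ ψ).domain := ⟪e p, (x : H)⟫_ℂ • v0
    have hu : (u : H) = ⟪e p, (x : H)⟫_ℂ • e p := by
      refine Eq.trans ?_ (congrArg (fun y => ⟪e p, (x : H)⟫_ℂ • y) hv0)
      rfl
    have hAu : perturb A φ ψ u = ⟪e p, (x : H)⟫_ℂ • (lam p : ℂ) • e p := by
      rw [perturb_apply, hu, inner_smul_right, hφp, mul_zero, zero_smul, add_zero, ← hv0']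
      exact A.map_smul _ v0
    have hAx : ⟪e p, perturb A φ ψ x⟫_ℂ = (lam p : ℂ) * ⟪e p, (x : H)⟫_ℂ := by
      rw [perturb_apply, inner_add_right, inner_smul_right, hψp, mul_zero, add_zero]
      exact (hA x (A x)).1 ⟨x, rfl, rfl⟩ p
    refine ⟨u, x - u, by abel, ?_, ?_, ?_, ?_⟩
    · exact (hmem _).2 ⟨_, hu⟩
    · rw [hspan, Submodule.mem_orthogonal_singleton_iff_inner_right, Submodule.coe_sub,
        inner_sub_right, hu, inner_smul_right, inner_basis]
      simp
    · rw [hAu, hspan]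
      exact Submodule.smul_mem _ _ (Submodule.smul_mem _ _ (Submodule.mem_span_singleton_self _))
    · rw [hspan, Submodule.mem_orthogonal_singleton_iff_inner_right, LinearPMap.map_sub,
        inner_sub_right, hAu, inner_smul_right, inner_smul_right, inner_basis, hAx]
      simp [mul_comm]

end Relation

section Multiplier

variable {H : Type*} [NormedAddCommGroup H] [InnerProductSpace ℂ H]
variable {I : Type*} (e : HilbertBasis I ℂ H)

theorem exists_inner_basis_eq_mul {c : I → ℂ} {C : ℝ} (hc : ∀ n, ‖c n‖ ≤ C) (x : H) :
    ∃ y : H, ∀ n, ⟪e n, y⟫_ℂ = c n * ⟪e n, x⟫_ℂ := by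
  have hs : Summable fun n => ‖e.repr x n‖ ^ (2 : ℝ) := by
    simpa using (lp.memℓp (e.repr x)).summable (by norm_num)
  have hm : Memℓp (fun n => c n * e.repr x n) 2 := by
    refine memℓp_gen ?_
    refine (hs.mul_left (C ^ 2)).of_nonneg_of_le (fun n => by positivity) fun n => ?_
    have h2 : (ENNReal.toReal 2) = (2 : ℝ) := by norm_num
    rw [h2, Real.rpow_two, Real.rpow_two, norm_mul, mul_pow]
    gcongr
    exact hc n
  refine ⟨e.repr.symm ⟨_, hm⟩, fun n => ?_⟩
  rw [← e.repr_apply_apply, LinearIsometryEquiv.apply_symm_apply, ← e.repr_apply_apply]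

theorem exists_linearMap_inner_basis_eq_mul {c : I → ℂ} {C : ℝ} (hc : ∀ n, ‖c n‖ ≤ C) :
    ∃ S : Module.End ℂ H, ∀ x n, ⟪e n, S x⟫_ℂ = c n * ⟪e n, x⟫_ℂ := by
  choose S hS using exists_inner_basis_eq_mul e hc
  refine ⟨{ toFun := S, map_add' := fun x y => ?_, map_smul' := fun a x => ?_ }, hS⟩
  · refine hilbertBasis_ext e fun n => ?_
    rw [inner_add_right, hS, hS, hS, inner_add_right, mul_add]
  · refine hilbertBasis_ext e fun n => ?_
    simp only [RingHom.id_apply]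
    rw [inner_smul_right, hS, hS, inner_smul_right]
    ring

end Multiplier

section RootSubspace

variable {H : Type*} [NormedAddCommGroup H] [InnerProductSpace ℂ H]
variable {I : Type*} {A : H →ₗ.[ℂ] H} {e : HilbertBasis I ℂ H} {lam : I → ℝ} {φ ψ : H} {z : ℂ}

theorem kerPow_mono (T : H →ₗ.[ℂ] H) (z : ℂ) : Monotone (kerPow T z) := by
  refine monotone_nat_of_le_succ fun k => ?_
  induction k with
  | zero => exact bot_le
  | succ k ih => exact Submodule.map_mono (Submodule.comap_mono ih)

theorem mem_rootSubspace_iff {T : H →ₗ.[ℂ] H} {x : H} :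
    x ∈ rootSubspace T z ↔ ∃ k, x ∈ kerPow T z k :=
  Submodule.mem_iSup_of_directed _ (kerPow_mono T z).directed_le

theorem isEigenvalue_of_algMult_ne_zero {T : H →ₗ.[ℂ] H} (h : algMult T z ≠ 0) :
    IsEigenvalue T z := by
  intro h0
  have hk : ∀ k, kerPow T z k = ⊥ := fun k => by
    induction k with
    | zero => rfl
    | succ k ih => rw [kerPow, ih]; exact h0
  have hr : rootSubspace T z = ⊥ := by simp only [rootSubspace, hk, iSup_bot]
  apply h
  rw [algMult, hr]
  simp

theorem algMult_ne_zero_of_isEigenvalue {T : H →ₗ.[ℂ] H} (h : IsEigenvalue T z) :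
    algMult T z ≠ 0 := by
  intro h0
  apply h
  rw [algMult, Cardinal.toENat_eq_zero, Submodule.rank_eq_zero] at h0
  rw [← le_bot_iff, ← h0]
  exact le_iSup (kerPow T z) 1

theorem IsDiagonal.mem_rootSubspace_of_shiftRel (hA : IsDiagonal A e lam) {x y : H}
    (h : ShiftRel e lam φ ψ z x y) (hy : y ∈ rootSubspace (perturb A φ ψ) z) :
    x ∈ rootSubspace (perturb A φ ψ) z := by
  obtain ⟨k, hk⟩ := mem_rootSubspace_iff.1 hy
  exact mem_rootSubspace_iff.2 ⟨k + 1, hA.mem_kerPow_succ_iff.2 ⟨y, hk, h⟩⟩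

theorem IsDiagonal.rootSubspace_le (hA : IsDiagonal A e lam) {N : Submodule ℂ H}
    (h : ∀ x y, ShiftRel e lam φ ψ z x y → y ∈ N → x ∈ N) :
    rootSubspace (perturb A φ ψ) z ≤ N := by
  intro x hx
  obtain ⟨k, hk⟩ := mem_rootSubspace_iff.1 hx
  induction k generalizing x with
  | zero => rw [(Submodule.mem_bot ℂ).1 hk]; exact zero_mem _
  | succ k ih =>
    obtain ⟨y, hy, hxy⟩ := hA.mem_kerPow_succ_iff.1 hk
    exact h x y hxy (ih (mem_rootSubspace_iff.2 ⟨k, hy⟩) hy)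

/-- `S` is the resolvent of the diagonal operator at `z`, reduced by the kernel if `z` is an
eigenvalue. -/
def IsReducedResolvent (e : HilbertBasis I ℂ H) (lam : I → ℝ) (z : ℂ) (S : Module.End ℂ H) :
    Prop :=
  ∀ x n, ⟪e n, S x⟫_ℂ = ((lam n : ℂ) - z)⁻¹ * ⟪e n, x⟫_ℂ

/-- The Taylor coefficients at `z` of `1 + ⟨(A - ·)⁻¹ ψ, φ⟩`. -/
noncomputable def taylorCoeff (S : Module.End ℂ H) (φ ψ : H) (j : ℕ) : ℂ :=
  ⟪φ, (S ^ (j + 1)) ψ⟫_ℂ + if j = 0 then 1 else 0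

/-- The span of `S ψ, …, S ^ m ψ`. -/
noncomputable def chainSpan (S : Module.End ℂ H) (ψ : H) (m : ℕ) : Submodule ℂ H :=
  Submodule.span ℂ (Set.range fun i : Fin m => (S ^ (i.1 + 1)) ψ)

variable {S : Module.End ℂ H}

theorem mem_chainSpan {m j : ℕ} (hj : j < m) : (S ^ (j + 1)) ψ ∈ chainSpan S ψ m :=
  Submodule.subset_span ⟨⟨j, hj⟩, rfl⟩

theorem IsReducedResolvent.inner_pow (hS : IsReducedResolvent e lam z S) (j : ℕ) (x : H) (n : I) :
    ⟪e n, (S ^ j) x⟫_ℂ = ((lam n : ℂ) - z)⁻¹ ^ j * ⟪e n, x⟫_ℂ := by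
  induction j with
  | zero => simp
  | succ j ih => rw [pow_succ', Module.End.mul_apply, hS, ih, pow_succ', mul_assoc]

theorem taylorCoeff_zero : taylorCoeff S φ ψ 0 = ⟪φ, S ψ⟫_ℂ + 1 := by
  simp [taylorCoeff]

theorem inner_pow_eq_taylorCoeff {j : ℕ} (hj : j ≠ 0) :
    ⟪φ, (S ^ (j + 1)) ψ⟫_ℂ = taylorCoeff S φ ψ j := by
  simp [taylorCoeff, hj]

theorem linearIndependent_chain {m : ℕ} (h0 : ∀ j < m, taylorCoeff S φ ψ j = 0)
    (hm : taylorCoeff S φ ψ m ≠ 0) :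
    LinearIndependent ℂ fun i : Fin m => (S ^ (i.1 + 1)) ψ := by
  rw [Fintype.linearIndependent_iff]
  intro g hg
  have key : ∀ k : ℕ, ∀ i : Fin m, i.1 + k + 1 = m → g i = 0 := by
    intro k
    induction k using Nat.strong_induction_on with
    | _ k ih =>
      intro i hi
      have h1 : ∑ i' : Fin m, g i' * taylorCoeff S φ ψ (i'.1 + k + 1) = 0 := by
        have h2 := congrArg (fun x => ⟪φ, (S ^ (k + 1)) x⟫_ℂ) hg
        simp only [map_sum, map_smul, inner_sum, inner_smul_right, map_zero, inner_zero_right] at h2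
        rw [← h2]
        refine Finset.sum_congr rfl fun i' _ => ?_
        rw [← Module.End.mul_apply, ← pow_add, ← inner_pow_eq_taylorCoeff (by omega)]
        congr 4
        omega
      rw [Finset.sum_eq_single i] at h1
      · rw [hi] at h1
        exact (mul_eq_zero.1 h1).resolve_right hm
      · intro i' _ hi'
        rcases lt_or_gt_of_ne (fun h => hi' (Fin.ext h) : i'.1 ≠ i.1) with h | h
        · rw [h0 _ (by omega), mul_zero]
        · rw [ih (m - 1 - i'.1) (by omega) i' (by omega), zero_mul]
      · simp
  exact fun i => key (m - 1 - i.1) i (by omega)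

theorem map_chainSpan {m : ℕ} (h0 : ∀ j < m, taylorCoeff S φ ψ j = 0) {y : H}
    (hy : y ∈ chainSpan S ψ m) :
    ∃ y' ∈ chainSpan S ψ m, ∃ c : ℂ, S y = y' + c • (S ^ (m + 1)) ψ ∧
      ⟪φ, S y⟫_ℂ = c * taylorCoeff S φ ψ m ∧ (m = 0 → c = 0) := by
  induction hy using Submodule.span_induction with
  | mem x hx =>
    obtain ⟨i, rfl⟩ := hx
    have h1 : S ((S ^ (i.1 + 1)) ψ) = (S ^ (i.1 + 1 + 1)) ψ := by
      rw [pow_succ' S (i.1 + 1), Module.End.mul_apply]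
    simp only [h1]
    rw [inner_pow_eq_taylorCoeff (by omega)]
    by_cases hi : i.1 + 1 < m
    · exact ⟨_, mem_chainSpan hi, 0, by simp, by rw [h0 _ hi, zero_mul], fun _ => rfl⟩
    · have hi' : i.1 + 1 = m := by omega
      refine ⟨0, zero_mem _, 1, ?_, ?_, by omega⟩
      · rw [hi', zero_add, one_smul]
      · rw [hi', one_mul]
  | zero => exact ⟨0, zero_mem _, 0, by simp, by simp, fun _ => rfl⟩
  | add x y _ _ hx hy =>
    obtain ⟨x', hx', c, h1, h2, h3⟩ := hx
    obtain ⟨y', hy', d, h4, h5, h6⟩ := hy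
    refine ⟨x' + y', add_mem hx' hy', c + d, ?_, ?_, fun h => by rw [h3 h, h6 h, add_zero]⟩
    · rw [map_add, h1, h4]; module
    · rw [map_add, inner_add_right, h2, h5]; ring
  | smul a x _ hx =>
    obtain ⟨x', hx', c, h1, h2, h3⟩ := hx
    refine ⟨a • x', Submodule.smul_mem _ _ hx', a * c, ?_, ?_, fun h => by rw [h3 h, mul_zero]⟩
    · rw [map_smul, h1]; module
    · rw [map_smul, inner_smul_right, h2]; ring

theorem algMult_eq_of_rootSubspace_eq {T : H →ₗ.[ℂ] H} {m : ℕ} {v : Fin m → H}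
    (hv : LinearIndependent ℂ v) (h : rootSubspace T z = Submodule.span ℂ (Set.range v)) :
    algMult T z = m := by
  rw [algMult, h, rank_span hv]
  change (Set.range v).encard = m
  rw [← Set.image_univ, hv.injective.encard_image, Set.encard_univ]
  simp

theorem ShiftRel.eq_sub (hz : ∀ n, (lam n : ℂ) ≠ z) (hS : IsReducedResolvent e lam z S)
    {x y : H} (h : ShiftRel e lam φ ψ z x y) : x = S y - ⟪φ, x⟫_ℂ • S ψ := by
  refine hilbertBasis_ext e fun n => ?_
  have := sub_ne_zero.2 (hz n)
  rw [inner_sub_right, inner_smul_right, hS, hS, ← h n]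
  field_simp
  ring

theorem ShiftRel.eq_add_sub {p : I} (hlam : Function.Injective lam)
    (hS : IsReducedResolvent e lam (lam p) S)
    {x y : H} (h : ShiftRel e lam φ ψ (lam p) x y) :
    x = ⟪e p, x⟫_ℂ • e p + S y - ⟪φ, x⟫_ℂ • S ψ := by
  classical
  refine hilbertBasis_ext e fun n => ?_
  rw [inner_sub_right, inner_add_right, inner_smul_right, inner_smul_right, hS, hS, ← h n,
    inner_basis]
  by_cases hn : n = p
  · subst hn; simp
  have : (lam n : ℂ) - lam p ≠ 0 := sub_ne_zero.2 fun h => hn (hlam (by exact_mod_cast h))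
  rw [if_neg hn]
  field_simp
  ring

theorem IsReducedResolvent.shiftRel_pow (hS : IsReducedResolvent e lam z S)
    {m j : ℕ} (h0 : ∀ j < m, taylorCoeff S φ ψ j = 0) (hj : j + 1 < m) :
    ShiftRel e lam φ ψ z ((S ^ (j + 2)) ψ) ((S ^ (j + 1)) ψ) := fun n => by
  rw [inner_pow_eq_taylorCoeff (φ := φ) (by omega), h0 _ hj, hS.inner_pow, hS.inner_pow, zero_mul, add_zero]
  by_cases hn : (lam n : ℂ) - z = 0
  · simp [hn]
  · rw [pow_succ _ (j + 1)]
    linear_combination ((lam n : ℂ) - z)⁻¹ ^ (j + 1) * ⟪e n, ψ⟫_ℂ * mul_inv_cancel₀ hn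

/-- Outside the spectrum of `A`, the algebraic multiplicity is the order of the zero of
`1 + ⟨(A - ·)⁻¹ ψ, φ⟩`. -/
theorem IsDiagonal.algMult_eq_of_forall_ne (hA : IsDiagonal A e lam)
    (hz : ∀ n, (lam n : ℂ) ≠ z) (hS : IsReducedResolvent e lam z S) {m : ℕ}
    (h0 : ∀ j < m, taylorCoeff S φ ψ j = 0) (hm : taylorCoeff S φ ψ m ≠ 0) :
    algMult (perturb A φ ψ) z = m := by
  refine algMult_eq_of_rootSubspace_eq (linearIndependent_chain h0 hm) (le_antisymm ?_ ?_)
  · refine hA.rootSubspace_le (N := chainSpan S ψ m) fun x y hxy hy => ?_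
    have hx := hxy.eq_sub hz hS
    obtain ⟨y', hy', c, h1, h2, h3⟩ := map_chainSpan h0 hy
    have h4 : ⟪φ, x⟫_ℂ * taylorCoeff S φ ψ 0 = c * taylorCoeff S φ ψ m := by
      have := congrArg (fun x => ⟪φ, x⟫_ℂ) hx
      simp only [inner_sub_right, inner_smul_right] at this
      rw [taylorCoeff_zero]
      linear_combination this + h2
    have hc : c = 0 := by
      rcases Nat.eq_zero_or_pos m with h | h
      · exact h3 h
      · rw [h0 0 h, mul_zero, eq_comm] at h4
        exact (mul_eq_zero.1 h4).resolve_right hm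
    rw [hx, h1, hc, zero_smul, add_zero]
    rcases Nat.eq_zero_or_pos m with h | h
    · subst h
      rw [hc, zero_mul] at h4
      rw [(mul_eq_zero.1 h4).resolve_right hm, zero_smul, sub_zero]
      exact hy'
    · refine sub_mem hy' (Submodule.smul_mem _ _ ?_)
      simpa using mem_chainSpan (S := S) (ψ := ψ) h
  · rw [Submodule.span_le]
    rintro _ ⟨⟨i, hi⟩, rfl⟩
    simp only [SetLike.mem_coe]
    induction i with
    | zero =>
      refine hA.mem_rootSubspace_of_shiftRel (y := 0) (fun n => ?_) (zero_mem _)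
      have h1 := h0 0 hi
      rw [taylorCoeff_zero] at h1
      have := sub_ne_zero.2 (hz n)
      simp only [zero_add, pow_one, inner_zero_right]
      rw [hS, eq_neg_of_add_eq_zero_left h1]
      field_simp
      ring
    | succ i ih => exact hA.mem_rootSubspace_of_shiftRel (hS.shiftRel_pow h0 hi) (ih (by omega))

theorem inner_eq_zero_of_mem_chainSpan {p : I} (hS : IsReducedResolvent e lam (lam p) S)
    {m : ℕ} {y : H} (hy : y ∈ chainSpan S ψ m) : ⟪e p, y⟫_ℂ = 0 := by
  induction hy using Submodule.span_induction with
  | mem x hx =>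
    obtain ⟨i, rfl⟩ := hx
    simp [hS.inner_pow]
  | zero => simp
  | add x y _ _ hx hy => rw [inner_add_right, hx, hy, add_zero]
  | smul a x _ hx => rw [inner_smul_right, hx, mul_zero]

theorem algMult_eq_succ_of_rootSubspace_eq {T : H →ₗ.[ℂ] H} {p : I}
    (hS : IsReducedResolvent e lam (lam p) S) {m : ℕ}
    (h0 : ∀ j < m, taylorCoeff S φ ψ j = 0) (hm : taylorCoeff S φ ψ m ≠ 0)
    {v : H} (hv : ⟪e p, v⟫_ℂ ≠ 0)
    (h : rootSubspace T (lam p) = Submodule.span ℂ {v} ⊔ chainSpan S ψ m) :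
    algMult T (lam p) = (m + 1 : ℕ) := by
  refine algMult_eq_of_rootSubspace_eq (v := Fin.cons v fun i : Fin m => (S ^ (i.1 + 1)) ψ) ?_ ?_
  · exact linearIndependent_finCons.2 ⟨linearIndependent_chain h0 hm,
      fun hmem => hv (inner_eq_zero_of_mem_chainSpan hS hmem)⟩
  · rw [h, Fin.range_cons, Submodule.span_insert]
    rfl

/-- At an eigenvalue `lam p` of `A` for which `φ` or `ψ` is orthogonal to the eigenvector, the
algebraic multiplicity is one more than the order of the zero of `1 + ⟨(A - ·)⁻¹ ψ, φ⟩`. -/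
theorem IsDiagonal.algMult_eq_of_eq (hA : IsDiagonal A e lam) (hlam : Function.Injective lam)
    {p : I} (hp : ⟪φ, e p⟫_ℂ * ⟪e p, ψ⟫_ℂ = 0) (hS : IsReducedResolvent e lam (lam p) S) {m : ℕ}
    (h0 : ∀ j < m, taylorCoeff S φ ψ j = 0) (hm : taylorCoeff S φ ψ m ≠ 0) :
    algMult (perturb A φ ψ) (lam p) = (m + 1 : ℕ) := by
  classical
  have hne : ∀ n, n ≠ p → (lam n : ℂ) - lam p ≠ 0 := fun n hn =>
    sub_ne_zero.2 fun h => hn (hlam (by exact_mod_cast h))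
  have hSp : S (e p) = 0 := hilbertBasis_ext e fun n => by
    rw [hS, inner_basis]
    by_cases hn : n = p <;> simp [hn]
  have hchain : Submodule.span ℂ {e p} ≤ rootSubspace (perturb A φ ψ) (lam p) ∨
      ⟪e p, ψ⟫_ℂ = 0 → chainSpan S ψ m ≤ rootSubspace (perturb A φ ψ) (lam p) := by
    intro h
    rw [chainSpan, Submodule.span_le]
    rintro _ ⟨⟨i, hi⟩, rfl⟩
    simp only [SetLike.mem_coe]
    induction i with
    | zero =>
      refine hA.mem_rootSubspace_of_shiftRel (y := -(⟪e p, ψ⟫_ℂ • e p)) (fun n => ?_) ?_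
      · have h1 := h0 0 hi
        rw [taylorCoeff_zero] at h1
        simp only [zero_add, pow_one]
        rw [hS, eq_neg_of_add_eq_zero_left h1, inner_neg_right, inner_smul_right, inner_basis]
        by_cases hn : n = p
        · subst hn; simp
        have := hne n hn
        rw [if_neg hn]
        field_simp
        ring
      · rcases h with h | h
        · exact neg_mem (Submodule.smul_mem _ _ (h (Submodule.mem_span_singleton_self _)))
        · rw [h, zero_smul, neg_zero]; exact zero_mem _
    | succ i ih => exact hA.mem_rootSubspace_of_shiftRel (hS.shiftRel_pow h0 hi) (ih (by omega))
  have hu1 : ∀ c : ℂ, 0 < m → c • S ψ ∈ chainSpan S ψ m := fun c h => by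
    refine Submodule.smul_mem _ _ ?_
    simpa using mem_chainSpan (S := S) (ψ := ψ) h
  by_cases hφ : ⟪φ, e p⟫_ℂ = 0
  · have hep : Submodule.span ℂ {e p} ≤ rootSubspace (perturb A φ ψ) (lam p) := by
      rw [Submodule.span_singleton_le_iff_mem]
      refine hA.mem_rootSubspace_of_shiftRel (y := 0) (fun n => ?_) (zero_mem _)
      rw [hφ, inner_basis]
      by_cases hn : n = p <;> simp [hn]
    refine algMult_eq_succ_of_rootSubspace_eq hS h0 hm (v := e p) (by rw [inner_basis]; simp)
      (le_antisymm (hA.rootSubspace_le fun x y hxy hy => ?_) (sup_le hep (hchain (Or.inl hep))))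
    obtain ⟨_, hb, y0, hy0, rfl⟩ := Submodule.mem_sup.1 hy
    obtain ⟨b, rfl⟩ := Submodule.mem_span_singleton.1 hb
    have hx := hxy.eq_add_sub hlam hS
    rw [map_add, map_smul, hSp, smul_zero, zero_add] at hx
    obtain ⟨y', hy', c, h1, h2, h3⟩ := map_chainSpan h0 hy0
    have h4 : ⟪φ, x⟫_ℂ * taylorCoeff S φ ψ 0 = c * taylorCoeff S φ ψ m := by
      have := congrArg (fun x => ⟪φ, x⟫_ℂ) hx
      simp only [inner_sub_right, inner_add_right, inner_smul_right, hφ] at this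
      rw [taylorCoeff_zero]
      linear_combination this + h2
    have hc : c = 0 := by
      rcases Nat.eq_zero_or_pos m with h | h
      · exact h3 h
      · rw [h0 0 h, mul_zero, eq_comm] at h4
        exact (mul_eq_zero.1 h4).resolve_right hm
    rw [hx, h1, hc, zero_smul, add_zero, add_sub_assoc]
    refine Submodule.add_mem_sup (Submodule.smul_mem _ _ (Submodule.mem_span_singleton_self _)) ?_
    rcases Nat.eq_zero_or_pos m with h | h
    · subst h
      rw [hc, zero_mul] at h4
      rw [(mul_eq_zero.1 h4).resolve_right hm, zero_smul, sub_zero]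
      exact hy'
    · exact sub_mem hy' (hu1 _ h)
  · have hψ : ⟪e p, ψ⟫_ℂ = 0 := (mul_eq_zero.1 hp).resolve_left hφ
    set v : H := ⟪φ, e p⟫_ℂ • (S ^ (m + 1)) ψ - taylorCoeff S φ ψ m • e p with hvdef
    have hvp : ⟪e p, v⟫_ℂ = -taylorCoeff S φ ψ m := by
      rw [hvdef, inner_sub_right, inner_smul_right, inner_smul_right, hS.inner_pow, inner_basis]
      simp
    have hφv : ⟪φ, v⟫_ℂ = if m = 0 then -⟪φ, e p⟫_ℂ else 0 := by
      rw [hvdef, inner_sub_right, inner_smul_right, inner_smul_right, taylorCoeff]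
      split_ifs <;> ring
    have hch := hchain (Or.inr hψ)
    have hv : v ∈ rootSubspace (perturb A φ ψ) (lam p) := by
      refine hA.mem_rootSubspace_of_shiftRel
        (y := if m = 0 then 0 else ⟪φ, e p⟫_ℂ • (S ^ m) ψ) (fun n => ?_) ?_
      · rw [hφv]
        by_cases hn : n = p
        · subst hn
          rw [hψ]
          split_ifs with h
          · simp
          · simp [hS.inner_pow, h]
        · have := hne n hn
          rw [hvdef, inner_sub_right, inner_smul_right, inner_smul_right, inner_basis, if_neg hn,
            hS.inner_pow]
          split_ifs with h
          · subst h
            simp only [zero_add, pow_one, inner_zero_right]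
            field_simp
            ring
          · rw [inner_smul_right, hS.inner_pow, pow_succ]
            linear_combination ⟪φ, e p⟫_ℂ * ((lam n : ℂ) - lam p)⁻¹ ^ m * ⟪e n, ψ⟫_ℂ *
              mul_inv_cancel₀ this
      · split_ifs with h
        · exact zero_mem _
        · obtain ⟨k, rfl⟩ := Nat.exists_eq_succ_of_ne_zero h
          exact Submodule.smul_mem _ _ (hch (mem_chainSpan (Nat.lt_succ_self k)))
    refine algMult_eq_succ_of_rootSubspace_eq hS h0 hm (v := v) (by simpa [hvp] using hm)
      (le_antisymm (hA.rootSubspace_le fun x y hxy hy => ?_)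
        (sup_le (by rwa [Submodule.span_singleton_le_iff_mem]) hch))
    obtain ⟨_, hb, y0, hy0, rfl⟩ := Submodule.mem_sup.1 hy
    obtain ⟨b, rfl⟩ := Submodule.mem_span_singleton.1 hb
    have hb0 : b = 0 := by
      have h1 := hxy p
      rw [sub_self, zero_mul, hψ, mul_zero, inner_add_right, inner_smul_right, hvp,
        inner_eq_zero_of_mem_chainSpan hS hy0] at h1
      simpa [hm] using h1
    have hx := hxy.eq_add_sub hlam hS
    rw [hb0, zero_smul, zero_add] at hx
    obtain ⟨y', hy', c, h1, h2, h3⟩ := map_chainSpan h0 hy0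
    set a := ⟪e p, x⟫_ℂ
    have h4 : ⟪φ, x⟫_ℂ * taylorCoeff S φ ψ 0 = a * ⟪φ, e p⟫_ℂ + c * taylorCoeff S φ ψ m := by
      have := congrArg (fun x => ⟪φ, x⟫_ℂ) hx
      simp only [inner_sub_right, inner_add_right, inner_smul_right] at this
      rw [taylorCoeff_zero]
      linear_combination this + h2
    have hav : (-a / taylorCoeff S φ ψ m) • v ∈ Submodule.span ℂ {v} :=
      Submodule.smul_mem _ _ (Submodule.mem_span_singleton_self _)
    rcases Nat.eq_zero_or_pos m with h | h
    · subst h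
      rw [h3 rfl, zero_mul, add_zero] at h4
      have h5 : x = (-a / taylorCoeff S φ ψ 0) • v + y' := by
        rw [hx, h1, h3 rfl, eq_div_of_mul_eq hm h4, hvdef]
        have h6 : a = a / taylorCoeff S φ ψ 0 * taylorCoeff S φ ψ 0 := by field_simp
        nth_rw 1 [h6]
        simp only [zero_add, pow_one]
        module
      rw [h5]
      exact Submodule.add_mem_sup hav hy'
    · rw [h0 0 h, mul_zero] at h4
      have hc : c = -a / taylorCoeff S φ ψ m * ⟪φ, e p⟫_ℂ := by
        field_simp
        linear_combination -h4
      have h5 : x = (-a / taylorCoeff S φ ψ m) • v + (y' - ⟪φ, x⟫_ℂ • S ψ) := by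
        nth_rw 1 [hx]
        rw [h1, hc, hvdef]
        have h6 : a = a / taylorCoeff S φ ψ m * taylorCoeff S φ ψ m := by field_simp
        nth_rw 1 [h6]
        module
      rw [h5]
      exact Submodule.add_mem_sup hav (sub_mem hy' (hu1 _ h))

theorem IsDiagonal.algMult_eq_zero (hA : IsDiagonal A e lam) (hlam : Function.Injective lam)
    {p : I} (hp : ⟪φ, e p⟫_ℂ * ⟪e p, ψ⟫_ℂ ≠ 0) :
    algMult (perturb A φ ψ) (lam p) = 0 := by
  by_contra hne
  obtain ⟨x, hx, hx0⟩ := (Submodule.ne_bot_iff _).1 (isEigenvalue_of_algMult_ne_zero hne)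
  rw [hA.mem_eigenspace_perturb_iff] at hx
  have h1 : ⟪φ, x⟫_ℂ = 0 := by
    have := hx p
    rw [sub_self, zero_mul, zero_add, inner_zero_right] at this
    exact (mul_eq_zero.1 this).resolve_right (right_ne_zero_of_mul hp)
  have h2 : x = ⟪e p, x⟫_ℂ • e p := by
    classical
    refine hilbertBasis_ext e fun n => ?_
    rw [inner_smul_right, inner_basis]
    by_cases hn : n = p
    · simp [hn]
    have h := hx n
    rw [h1, zero_mul, add_zero, inner_zero_right] at h
    rw [if_neg hn, mul_zero]
    exact (mul_eq_zero.1 h).resolve_left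
      (sub_ne_zero.2 fun h => hn (hlam (by exact_mod_cast h)))
  refine hx0 (hx.zero_right_eq_zero_of_inner_eq_zero hlam ?_ h1)
  rw [h2, inner_smul_right] at h1
  exact (mul_eq_zero.1 h1).resolve_right (left_ne_zero_of_mul hp)

end RootSubspace

section CauchySum

variable {I : Type*} {lam : I → ℝ} {a b : I → ℂ} {z : ℂ}

/-- The terms of `lam` keep a common positive distance from each other. -/
def UniformlySeparated (lam : I → ℝ) : Prop :=
  ∃ d : ℝ, 0 < d ∧ ∀ m n : I, m ≠ n → d ≤ |lam m - lam n|

theorem UniformlySeparated.exists_gap (hsep : UniformlySeparated lam) (z : ℂ) :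
    ∃ δ : ℝ, 0 < δ ∧ ∀ n, (lam n : ℂ) ≠ z → δ ≤ ‖(lam n : ℂ) - z‖ := by
  obtain ⟨d, hd, hsep⟩ := hsep
  have key : ∀ m n, ‖(lam m : ℂ) - z‖ < d / 2 → ‖(lam n : ℂ) - z‖ < d / 2 → m = n := by
    intro m n hm hn
    by_contra hmn
    have h1 := hsep m n hmn
    have h2 : ‖(lam m : ℂ) - lam n‖ = |lam m - lam n| := by
      rw [← Complex.ofReal_sub, Complex.norm_real, Real.norm_eq_abs]
    have h3 := norm_sub_le ((lam m : ℂ) - z) ((lam n : ℂ) - z)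
    rw [sub_sub_sub_cancel_right, h2] at h3
    linarith
  by_cases h : ∃ m, (lam m : ℂ) ≠ z ∧ ‖(lam m : ℂ) - z‖ < d / 2
  · obtain ⟨m, hm, hm'⟩ := h
    refine ⟨‖(lam m : ℂ) - z‖, norm_pos_iff.2 (sub_ne_zero.2 hm), fun n hn => ?_⟩
    by_contra! hlt
    rw [key n m (hlt.trans hm') hm'] at hlt
    exact lt_irrefl _ hlt
  · push Not at h
    exact ⟨d / 2, by linarith, h⟩

theorem UniformlySeparated.finite_norm_sub_le (hsep : UniformlySeparated lam) (c : ℂ) (R : ℝ) :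
    {n | ‖(lam n : ℂ) - c‖ ≤ R}.Finite := by
  obtain ⟨d, hd, hsep⟩ := hsep
  have hinj : Set.InjOn (fun n => ⌊lam n / d⌋) {n | ‖(lam n : ℂ) - c‖ ≤ R} := by
    intro m _ n _ hmn
    by_contra hne
    have h1 := Int.abs_sub_lt_one_of_floor_eq_floor hmn
    rw [← sub_div, abs_div, abs_of_pos hd, div_lt_one hd] at h1
    exact absurd (hsep m n hne) (not_le.2 h1)
  refine Set.Finite.of_finite_image ?_ hinj
  refine (Set.finite_Icc ⌊(c.re - R) / d⌋ ⌊(c.re + R) / d⌋).subset ?_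
  rintro _ ⟨n, hn, rfl⟩
  have h1 : |lam n - c.re| ≤ R := by
    have := (Complex.abs_re_le_norm ((lam n : ℂ) - c)).trans hn
    simpa using this
  rw [abs_le] at h1
  refine ⟨Int.floor_le_floor ?_, Int.floor_le_floor ?_⟩
  · gcongr; linarith
  · gcongr; linarith

/-- The function `w ↦ ∑ₙ bₙ / (λₙ - w)`. -/
noncomputable def cauchySum (lam : I → ℝ) (b : I → ℂ) (w : ℂ) : ℂ := ∑' n, b n / ((lam n : ℂ) - w)

theorem UniformlySeparated.summable_div (hsep : UniformlySeparated lam) (hb : Summable b) (w : ℂ) :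
    Summable fun n => b n / ((lam n : ℂ) - w) := by
  obtain ⟨δ, hδ, h⟩ := hsep.exists_gap w
  refine (hb.norm.mul_right δ⁻¹).of_norm_bounded fun n => ?_
  rw [norm_div, div_eq_mul_inv]
  by_cases hn : (lam n : ℂ) = w
  · simp only [hn, sub_self, norm_zero, inv_zero, mul_zero]; positivity
  · gcongr
    exact h n hn

theorem UniformlySeparated.summable_mul_inv_pow (hsep : UniformlySeparated lam) (hb : Summable b)
    (w : ℂ) (j : ℕ) : Summable fun n => b n * ((lam n : ℂ) - w)⁻¹ ^ j := by
  induction j with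
  | zero => simpa using hb
  | succ j ih => simpa only [pow_succ, ← mul_assoc, div_eq_mul_inv] using hsep.summable_div ih w

theorem UniformlySeparated.analyticAt_cauchySum (hsep : UniformlySeparated lam) (hb : Summable b)
    (hz : ∀ n, (lam n : ℂ) = z → b n = 0) : AnalyticAt ℂ (cauchySum lam b) z := by
  obtain ⟨δ, hδ, h⟩ := hsep.exists_gap z
  have hδ2 : 0 < δ / 2 := by linarith
  have hfar : ∀ n, (lam n : ℂ) ≠ z → ∀ w ∈ Metric.ball z (δ / 2), δ / 2 ≤ ‖(lam n : ℂ) - w‖ := by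
    intro n hn w hw
    rw [mem_ball_iff_norm] at hw
    have := norm_sub_norm_le ((lam n : ℂ) - z) (w - z)
    rw [sub_sub_sub_cancel_right] at this
    linarith [h n hn]
  have hd : DifferentiableOn ℂ (cauchySum lam b) (Metric.ball z (δ / 2)) := by
    refine Complex.differentiableOn_tsum_of_summable_norm (hb.norm.mul_right (δ / 2)⁻¹)
      (fun n => ?_) Metric.isOpen_ball fun n w hw => ?_
    · by_cases hn : (lam n : ℂ) = z
      · simp only [hz n hn, zero_div]
        exact differentiableOn_const 0
      · intro w hw
        have hw0 : (lam n : ℂ) - w ≠ 0 := norm_pos_iff.1 (hδ2.trans_le (hfar n hn w hw))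
        exact ((differentiableAt_const _).div
          ((differentiableAt_const _).sub differentiableAt_id) hw0).differentiableWithinAt
    · by_cases hn : (lam n : ℂ) = z
      · simp only [hz n hn, zero_div, norm_zero, zero_mul, le_refl]
      · rw [norm_div, div_eq_mul_inv]
        gcongr
        exact hfar n hn w hw
  exact hd.analyticAt (Metric.ball_mem_nhds _ hδ2)

/-- The Taylor coefficients of `1 + cauchySum lam a` at `z`. -/
noncomputable def cauchyCoeff (lam : I → ℝ) (a : I → ℂ) (z : ℂ) (j : ℕ) : ℂ :=
  (∑' n, a n * ((lam n : ℂ) - z)⁻¹ ^ (j + 1)) + if j = 0 then 1 else 0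

theorem UniformlySeparated.exists_one_add_cauchySum_eq (hsep : UniformlySeparated lam)
    (ha : Summable a) (hz : ∀ n, (lam n : ℂ) = z → a n = 0) {m : ℕ}
    (h0 : ∀ j < m, cauchyCoeff lam a z j = 0) :
    ∃ g : ℂ → ℂ, AnalyticAt ℂ g z ∧ g z = cauchyCoeff lam a z m ∧
      ∀ᶠ w in nhds z, 1 + cauchySum lam a w = (w - z) ^ m * g w := by
  let b : ℕ → I → ℂ := fun m n => a n * ((lam n : ℂ) - z)⁻¹ ^ m
  have hb : ∀ m, Summable (b m) := fun m => hsep.summable_mul_inv_pow ha z m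
  refine ⟨fun w => cauchySum lam (b m) w + if m = 0 then 1 else 0, ?_, ?_, ?_⟩
  · exact (hsep.analyticAt_cauchySum (hb m) fun n hn => by simp [b, hz n hn]).add analyticAt_const
  · simp only [cauchySum, cauchyCoeff, b, div_eq_mul_inv, pow_succ, mul_assoc]
  obtain ⟨δ, hδ, h⟩ := hsep.exists_gap z
  filter_upwards [Metric.ball_mem_nhds z hδ] with w hw
  rw [mem_ball_iff_norm] at hw
  induction m with
  | zero => simp [b, add_comm]
  | succ m ih =>
    rw [ih fun j hj => h0 j (by omega)]
    have h1 : cauchySum lam (b m) w =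
        (∑' n, b m n / ((lam n : ℂ) - z)) + (w - z) * cauchySum lam (b (m + 1)) w := by
      rw [cauchySum, cauchySum, ← tsum_mul_left, ← (hsep.summable_div (hb m) z).tsum_add
        ((hsep.summable_div (hb (m + 1)) w).mul_left _)]
      refine tsum_congr fun n => ?_
      by_cases hn : (lam n : ℂ) = z
      · simp [b, hz n hn]
      have h2 : (lam n : ℂ) - z ≠ 0 := sub_ne_zero.2 hn
      have h3 : (lam n : ℂ) - w ≠ 0 := by
        intro h3
        rw [sub_eq_zero] at h3
        have := h n hn
        rw [h3] at this
        linarith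
      simp only [b, pow_succ]
      field_simp
      ring
    have h2 : (∑' n, b m n / ((lam n : ℂ) - z)) + (if m = 0 then 1 else 0) = 0 := by
      refine Eq.trans ?_ (h0 m (by omega))
      simp only [cauchyCoeff, b, div_eq_mul_inv, pow_succ, mul_assoc]
    simp only [Nat.add_eq_zero_iff, one_ne_zero, and_false, if_false, add_zero]
    rw [h1, pow_succ]
    linear_combination (w - z) ^ m * h2

/-- The product of `1 + cauchySum lam a` and the polynomial `∏ (w - lam n)`, `n ∈ s`, without
the poles at `lam n`, `n ∈ s`. -/
noncomputable def clearedSum [DecidableEq I] (lam : I → ℝ) (a : I → ℂ) (s : Finset I)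
    (w : ℂ) : ℂ :=
  (∏ n ∈ s, (w - lam n)) * (1 + cauchySum lam (fun n => if n ∈ s then 0 else a n) w) -
    ∑ n ∈ s, a n * ∏ k ∈ s.erase n, (w - lam k)

theorem UniformlySeparated.analyticAt_clearedSum [DecidableEq I] (hsep : UniformlySeparated lam) (ha : Summable a)
    {s : Finset I} (hz : ∀ n ∉ s, (lam n : ℂ) ≠ z) : AnalyticAt ℂ (clearedSum lam a s) z := by
  have hprod : ∀ t : Finset I, AnalyticAt ℂ (fun w : ℂ => ∏ n ∈ t, (w - lam n)) z := fun t =>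
    Finset.analyticAt_fun_prod _ fun n _ => analyticAt_id.sub analyticAt_const
  have hs : Summable fun n => if n ∈ s then 0 else a n := by
    refine ha.norm.of_norm_bounded fun n => ?_
    split_ifs <;> simp
  refine ((hprod s).mul (analyticAt_const.add (hsep.analyticAt_cauchySum ?_ fun n hn => ?_))).sub
    (Finset.analyticAt_fun_sum _ fun n _ => analyticAt_const.mul (hprod _))
  · exact hs
  · rw [if_pos]
    by_contra h
    exact hz n h hn

theorem UniformlySeparated.clearedSum_eq [DecidableEq I] (hsep : UniformlySeparated lam) (ha : Summable a)
    {s : Finset I} (hz : ∀ n ∈ s, (lam n : ℂ) = z → a n = 0) :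
    clearedSum lam a s z = (∏ n ∈ s, (z - lam n)) * (1 + cauchySum lam a z) := by
  have hsum := hsep.summable_div ha z
  have h1 : cauchySum lam a z = (∑ n ∈ s, a n / ((lam n : ℂ) - z)) +
      cauchySum lam (fun n => if n ∈ s then 0 else a n) z := by
    have h2 : ∑ n ∈ s, a n / ((lam n : ℂ) - z) =
        ∑' n, (if n ∈ s then a n else 0) / ((lam n : ℂ) - z) := by
      rw [tsum_eq_sum (s := s)]
      · exact Finset.sum_congr rfl fun n hn => by rw [if_pos hn]
      · intro n hn; rw [if_neg hn, zero_div]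
    rw [h2, cauchySum, cauchySum, ← Summable.tsum_add]
    · refine tsum_congr fun n => ?_
      split_ifs <;> simp
    · refine hsum.norm.of_norm_bounded fun n => ?_
      split_ifs <;> simp [div_nonneg]
    · refine hsum.norm.of_norm_bounded fun n => ?_
      split_ifs <;> simp [div_nonneg]
  rw [clearedSum, h1]
  have h3 : ∑ n ∈ s, a n * ∏ k ∈ s.erase n, (z - lam k) =
      -((∏ n ∈ s, (z - lam n)) * ∑ n ∈ s, a n / ((lam n : ℂ) - z)) := by
    rw [Finset.mul_sum, ← Finset.sum_neg_distrib]
    refine Finset.sum_congr rfl fun n hn => ?_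
    rw [← Finset.mul_prod_erase s _ hn]
    by_cases hnz : (lam n : ℂ) = z
    · simp [hz n hn hnz]
    have : (lam n : ℂ) - z ≠ 0 := sub_ne_zero.2 hnz
    field_simp
    ring
  rw [h3]
  ring

theorem clearedSum_apply_eq [DecidableEq I] {s : Finset I} {p : I} (hp : p ∈ s) :
    clearedSum lam a s (lam p) = -(a p * ∏ k ∈ s.erase p, ((lam p : ℂ) - lam k)) := by
  rw [clearedSum, Finset.prod_eq_zero hp (sub_self _), zero_mul, zero_sub, Finset.sum_eq_single p]
  · intro n _ hn
    rw [Finset.prod_eq_zero (i := p) (by simp [hp, hn.symm]) (sub_self _), mul_zero]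
  · exact fun h => absurd hp h

theorem UniformlySeparated.clearedSum_eventuallyEq [DecidableEq I] (hsep : UniformlySeparated lam)
    (ha : Summable a) {s : Finset I} (hz : ∀ n ∈ s, (lam n : ℂ) = z → a n = 0) :
    clearedSum lam a s =ᶠ[nhds z]
      fun w => (∏ n ∈ s, (w - lam n)) * (1 + cauchySum lam a w) := by
  obtain ⟨δ, hδ, h⟩ := hsep.exists_gap z
  filter_upwards [Metric.ball_mem_nhds z hδ] with w hw
  refine hsep.clearedSum_eq ha fun n hn hnw => ?_
  by_cases hnz : (lam n : ℂ) = z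
  · exact hz n hn hnz
  · have := h n hnz
    rw [hnw] at this
    rw [mem_ball_iff_norm] at hw
    linarith

end CauchySum

section Order

variable {H : Type*} [NormedAddCommGroup H] [InnerProductSpace ℂ H]
variable {I : Type*} {A : H →ₗ.[ℂ] H} {e : HilbertBasis I ℂ H} {lam : I → ℝ} {φ ψ : H} {z : ℂ}

/-- The residues of `1 + ⟨(A - ·)⁻¹ ψ, φ⟩`, up to sign. -/
noncomputable def residues (e : HilbertBasis I ℂ H) (φ ψ : H) (n : I) : ℂ :=
  ⟪φ, e n⟫_ℂ * ⟪e n, ψ⟫_ℂ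

theorem summable_residues : Summable (residues e φ ψ) := e.summable_inner_mul_inner φ ψ

theorem UniformlySeparated.exists_isReducedResolvent (hsep : UniformlySeparated lam)
    (e : HilbertBasis I ℂ H) (z : ℂ) : ∃ S, IsReducedResolvent e lam z S := by
  obtain ⟨δ, hδ, h⟩ := hsep.exists_gap z
  refine exists_linearMap_inner_basis_eq_mul e (C := δ⁻¹) fun n => ?_
  by_cases hn : (lam n : ℂ) = z
  · simp [hn, hδ.le]
  · rw [norm_inv]
    gcongr
    exact h n hn

theorem IsReducedResolvent.taylorCoeff_eq {S : Module.End ℂ H}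
    (hS : IsReducedResolvent e lam z S) (j : ℕ) :
    taylorCoeff S φ ψ j = cauchyCoeff lam (residues e φ ψ) z j := by
  rw [taylorCoeff, cauchyCoeff, ← e.tsum_inner_mul_inner]
  congr 1
  refine tsum_congr fun n => ?_
  rw [hS.inner_pow, residues]
  ring

/-- The algebraic multiplicity as the order of an analytic function. -/
theorem IsDiagonal.algMult_eq_analyticOrderAt [DecidableEq I] (hA : IsDiagonal A e lam)
    (hlam : Function.Injective lam) (hsep : UniformlySeparated lam) {s : Finset I}
    (hz : ∀ n ∉ s, (lam n : ℂ) ≠ z)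
    (htop : analyticOrderAt (clearedSum lam (residues e φ ψ) s) z ≠ ⊤) :
    algMult (perturb A φ ψ) z = analyticOrderAt (clearedSum lam (residues e φ ψ) s) z := by
  set a := residues e φ ψ with hadef
  have ha : Summable a := summable_residues
  have han := hsep.analyticAt_clearedSum ha hz
  have hne : ∀ {p n : I}, n ≠ p → (lam p : ℂ) - lam n ≠ 0 := fun hn =>
    sub_ne_zero.2 fun h => hn (hlam (by exact_mod_cast h.symm))
  by_cases hpole : ∃ p, (lam p : ℂ) = z ∧ a p ≠ 0
  · obtain ⟨p, rfl, hp⟩ := hpole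
    have hps : p ∈ s := by
      by_contra h
      exact hz p h rfl
    rw [hA.algMult_eq_zero hlam hp, eq_comm, han.analyticOrderAt_eq_zero, clearedSum_apply_eq hps]
    refine neg_ne_zero.2 (mul_ne_zero hp (Finset.prod_ne_zero_iff.2 fun n hn => ?_))
    exact hne (Finset.ne_of_mem_erase hn)
  push Not at hpole
  obtain ⟨S, hS⟩ := hsep.exists_isReducedResolvent e z
  have hQ : ∃ (k : ℕ) (Q : ℂ → ℂ), AnalyticAt ℂ Q z ∧ Q z ≠ 0 ∧
      (∀ w : ℂ, ∏ n ∈ s, (w - lam n) = (w - z) ^ k * Q w) ∧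
      ∀ m : ℕ, (∀ j < m, taylorCoeff S φ ψ j = 0) → taylorCoeff S φ ψ m ≠ 0 →
        algMult (perturb A φ ψ) z = (m + k : ℕ) := by
    have hprod : ∀ t : Finset I, AnalyticAt ℂ (fun w : ℂ => ∏ n ∈ t, (w - lam n)) z := fun t =>
      Finset.analyticAt_fun_prod _ fun n _ => analyticAt_id.sub analyticAt_const
    by_cases hp : ∃ p, (lam p : ℂ) = z
    · obtain ⟨p, rfl⟩ := hp
      have hps : p ∈ s := by
        by_contra h
        exact hz p h rfl
      refine ⟨1, _, hprod (s.erase p), ?_, fun w => ?_, fun m h0 hm => ?_⟩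
      · exact Finset.prod_ne_zero_iff.2 fun n hn => hne (Finset.ne_of_mem_erase hn)
      · rw [pow_one, Finset.mul_prod_erase s (fun n => w - (lam n : ℂ)) hps]
      · exact hA.algMult_eq_of_eq hlam (hpole p rfl) hS h0 hm
    · push Not at hp
      refine ⟨0, _, hprod s, ?_, fun w => by rw [pow_zero, one_mul], fun m h0 hm => ?_⟩
      · exact Finset.prod_ne_zero_iff.2 fun n _ => sub_ne_zero.2 (hp n).symm
      · exact hA.algMult_eq_of_forall_ne hp hS h0 hm
  obtain ⟨k, Q, hQa, hQ0, hQ, hmult⟩ := hQ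
  have hfac : ∀ m : ℕ, (∀ j < m, taylorCoeff S φ ψ j = 0) → ∃ g : ℂ → ℂ, AnalyticAt ℂ g z ∧
      (taylorCoeff S φ ψ m ≠ 0 → g z ≠ 0) ∧
      ∀ᶠ w in nhds z, clearedSum lam a s w = (w - z) ^ (m + k) • g w := by
    intro m h0
    obtain ⟨g, hg, hgz, hgw⟩ := hsep.exists_one_add_cauchySum_eq ha hpole
      (fun j hj => (hS.taylorCoeff_eq j).symm.trans (h0 j hj))
    refine ⟨fun w => Q w * g w, hQa.mul hg, fun hm => mul_ne_zero hQ0 ?_, ?_⟩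
    · rwa [hgz, ← hS.taylorCoeff_eq]
    · filter_upwards [hgw, hsep.clearedSum_eventuallyEq ha (s := s) fun n _ => hpole n]
        with w h1 h2
      rw [h2, h1, hQ, smul_eq_mul, pow_add]
      ring
  have hex : ∃ m, taylorCoeff S φ ψ m ≠ 0 := by
    by_contra! hall
    obtain ⟨N, hN⟩ := ENat.ne_top_iff_exists.1 htop
    obtain ⟨g, hg, -, hgw⟩ := hfac (N + 1) fun j _ => hall j
    have := (natCast_le_analyticOrderAt han).2 ⟨g, hg, hgw⟩
    rw [← hN] at this
    have := Nat.cast_le.1 this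
    omega
  obtain ⟨g, hg, hgz, hgw⟩ := hfac (Nat.find hex) fun j hj => not_not.1 (Nat.find_min hex hj)
  rw [hmult (Nat.find hex) (fun j hj => not_not.1 (Nat.find_min hex hj)) (Nat.find_spec hex),
    eq_comm, han.analyticOrderAt_eq_natCast]
  exact ⟨g, hg, hgz (Nat.find_spec hex), hgw⟩

end Order

section Rouche

variable {f g : ℂ → ℂ} {c : ℂ} {R : ℝ}

theorem exists_eq_pow_mul_of_analyticOnNhd {U : Set ℂ} (hf : AnalyticOnNhd ℂ f U) {z₀ : ℂ}
    (hz₀ : z₀ ∈ U) (htop : analyticOrderAt f z₀ ≠ ⊤) :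
    ∃ g : ℂ → ℂ, AnalyticOnNhd ℂ g U ∧ g z₀ ≠ 0 ∧
      ∀ z, f z = (z - z₀) ^ analyticOrderNatAt f z₀ * g z := by
  classical
  obtain ⟨g₀, hg₀, hg₀0, hg₀f⟩ := ((hf z₀ hz₀).analyticOrderAt_ne_top).1 htop
  set k := analyticOrderNatAt f z₀
  set g : ℂ → ℂ := fun z => if z = z₀ then g₀ z₀ else f z / (z - z₀) ^ k with hg
  have hgz₀ : g z₀ = g₀ z₀ := if_pos rfl
  have hgne : ∀ z, z ≠ z₀ → g z = f z / (z - z₀) ^ k := fun z hz => if_neg hz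
  have hgg₀ : g =ᶠ[nhds z₀] g₀ := by
    filter_upwards [hg₀f] with z hz
    by_cases h : z = z₀
    · rw [h, hgz₀]
    · have := pow_ne_zero k (sub_ne_zero.2 h)
      rw [hgne z h, hz, smul_eq_mul]
      field_simp
  refine ⟨g, fun z hz => ?_, by rwa [hgz₀], fun z => ?_⟩
  · by_cases h : z = z₀
    · rw [h]; exact hg₀.congr hgg₀.symm
    · have h1 : AnalyticAt ℂ (fun w => f w / (w - z₀) ^ k) z :=
        (hf z hz).div ((analyticAt_id.sub analyticAt_const).pow k)
          (pow_ne_zero k (sub_ne_zero.2 h))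
      refine h1.congr ?_
      filter_upwards [isOpen_ne.mem_nhds h] with w hw
      rw [hgne w hw]
  · by_cases h : z = z₀
    · rw [h, hgz₀, ← smul_eq_mul]
      exact hg₀f.self_of_nhds
    · have := pow_ne_zero k (sub_ne_zero.2 h)
      rw [hgne z h]
      field_simp

theorem circleIntegral_logDeriv (hR : 0 < R) {Z : Finset ℂ}
    (hZ : ∀ z ∈ Z, z ∈ Metric.ball c R) (hf : AnalyticOnNhd ℂ f (Metric.closedBall c R))
    (hfZ : ∀ z ∈ Metric.closedBall c R, f z = 0 ↔ z ∈ Z)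
    (htop : ∀ z ∈ Z, analyticOrderAt f z ≠ ⊤) :
    ∮ z in C(c, R), logDeriv f z =
      2 * Real.pi * Complex.I * ((∑ z ∈ Z, analyticOrderNatAt f z : ℕ) : ℂ) := by
  classical
  induction Z using Finset.induction_on generalizing f with
  | empty =>
    have hdiff : DifferentiableOn ℂ (logDeriv f) (Metric.closedBall c R) := fun z hz => by
      refine DifferentiableAt.differentiableWithinAt ?_
      exact ((hf z hz).deriv.div (hf z hz) fun h => by simpa using (hfZ z hz).1 h).differentiableAt
    have := DiffContOnCl.circleIntegral_eq_zero (f := logDeriv f) hR.le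
      (DifferentiableOn.diffContOnCl (hdiff.mono Metric.closure_ball_subset_closedBall))
    simpa using this
  | insert z₀ Z hz₀ ih =>
    have hz₀b : z₀ ∈ Metric.ball c R := hZ _ (Finset.mem_insert_self _ _)
    have hz₀c := Metric.ball_subset_closedBall hz₀b
    obtain ⟨g, hg, hgz₀, hfg⟩ :=
      exists_eq_pow_mul_of_analyticOnNhd hf hz₀c (htop _ (Finset.mem_insert_self _ _))
    set k := analyticOrderNatAt f z₀
    have hord : ∀ z ∈ Metric.closedBall c R, z ≠ z₀ → analyticOrderAt f z = analyticOrderAt g z := by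
      intro z hz hne
      have h1 : f = (fun w => (w - z₀) ^ k) * g := funext hfg
      have h2 : AnalyticAt ℂ (fun w => (w - z₀) ^ k) z :=
        (analyticAt_id.sub analyticAt_const).pow k
      rw [h1, analyticOrderAt_mul h2 (hg z hz),
        h2.analyticOrderAt_eq_zero.2 (pow_ne_zero k (sub_ne_zero.2 hne)), zero_add]
    have hgZ : ∀ z ∈ Metric.closedBall c R, g z = 0 ↔ z ∈ Z := by
      intro z hz
      by_cases h : z = z₀
      · rw [h]; exact iff_of_false hgz₀ hz₀
      · have h1 := hfZ z hz
        rw [hfg z, mul_eq_zero, Finset.mem_insert] at h1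
        simpa [h, pow_ne_zero k (sub_ne_zero.2 h)] using h1
    have hne : ∀ z ∈ Z, z ≠ z₀ := fun z hz h => hz₀ (h ▸ hz)
    have hcl : ∀ z ∈ Z, z ∈ Metric.closedBall c R := fun z hz =>
      Metric.ball_subset_closedBall (hZ z (Finset.mem_insert_of_mem hz))
    have hint := ih (fun z hz => hZ z (Finset.mem_insert_of_mem hz)) hg hgZ fun z hz => by
      rw [← hord z (hcl z hz) (hne z hz)]
      exact htop z (Finset.mem_insert_of_mem hz)
    have hsum : ∑ z ∈ Z, analyticOrderNatAt g z = ∑ z ∈ Z, analyticOrderNatAt f z :=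
      Finset.sum_congr rfl fun z hz => by
        rw [analyticOrderNatAt, analyticOrderNatAt, hord z (hcl z hz) (hne z hz)]
    have hsphere : ∀ z ∈ Metric.sphere c R, z ≠ z₀ ∧ g z ≠ 0 := fun z hz => by
      have hzc := Metric.sphere_subset_closedBall hz
      refine ⟨?_, fun h => ?_⟩
      · rintro rfl
        rw [Metric.mem_sphere] at hz; rw [Metric.mem_ball] at hz₀b; linarith
      · have := hZ z (Finset.mem_insert_of_mem ((hgZ z hzc).1 h))
        rw [Metric.mem_sphere] at hz; rw [Metric.mem_ball] at this; linarith
    have hlog : Set.EqOn (logDeriv f) (fun z => (k : ℂ) * (z - z₀)⁻¹ + logDeriv g z)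
        (Metric.sphere c R) := fun z hz => by
      obtain ⟨h1, h2⟩ := hsphere z hz
      have hgd := (hg z (Metric.sphere_subset_closedBall hz)).differentiableAt
      have hpd : DifferentiableAt ℂ (fun w : ℂ => (w - z₀) ^ k) z := by fun_prop
      have hfeq : f = fun w => (w - z₀) ^ k * g w := funext hfg
      rw [hfeq, logDeriv_mul (f := fun w => (w - z₀) ^ k) z (pow_ne_zero k (sub_ne_zero.2 h1)) h2 hpd hgd]
      congr 1
      rw [logDeriv_fun_pow (by fun_prop)]
      simp [logDeriv_apply]
    rw [circleIntegral.integral_congr hR.le hlog, circleIntegral.integral_add, hint, hsum,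
      circleIntegral.integral_const_mul, circleIntegral.integral_sub_inv_of_mem_ball hz₀b,
      Finset.sum_insert hz₀]
    · push_cast; ring
    · refine ContinuousOn.circleIntegrable hR.le fun z hz => ?_
      have := sub_ne_zero.2 (hsphere z hz).1
      refine ContinuousAt.continuousWithinAt ?_
      fun_prop (disch := assumption)
    · refine ContinuousOn.circleIntegrable hR.le fun z hz => ?_
      have hgz := hg z (Metric.sphere_subset_closedBall hz)
      exact (hgz.deriv.div hgz (hsphere z hz).2).continuousAt.continuousWithinAt

theorem exists_finset_zeros (hR : 0 < R) (hf : AnalyticOnNhd ℂ f (Metric.closedBall c R))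
    (hs : ∀ z ∈ Metric.sphere c R, f z ≠ 0) :
    (∀ z ∈ Metric.closedBall c R, analyticOrderAt f z ≠ ⊤) ∧
      ∃ Z : Finset ℂ, (∀ z ∈ Z, z ∈ Metric.ball c R) ∧
        ∀ z ∈ Metric.closedBall c R, f z = 0 ↔ z ∈ Z := by
  obtain ⟨x, hx⟩ : (Metric.sphere c R).Nonempty := NormedSpace.sphere_nonempty.2 hR.le
  have hxc := Metric.sphere_subset_closedBall hx
  have htop : ∀ z ∈ Metric.closedBall c R, analyticOrderAt f z ≠ ⊤ := fun z hz => by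
    refine hf.analyticOrderAt_ne_top_of_isPreconnected (convex_closedBall c R).isPreconnected
      hxc hz ?_
    rw [(hf x hxc).analyticOrderAt_eq_zero.2 (hs x hx)]
    exact ENat.zero_ne_top
  have hfin : {z ∈ Metric.closedBall c R | f z = 0}.Finite := by
    by_contra hinf
    obtain ⟨z, hz, hacc⟩ := Set.Infinite.exists_accPt_of_subset_isCompact hinf
      (isCompact_closedBall c R) (Set.sep_subset _ _)
    refine htop z hz (analyticOrderAt_eq_top.2 ?_)
    refine (hf z hz).frequently_zero_iff_eventually_zero.1 ?_
    exact (accPt_iff_frequently_nhdsNE.1 hacc).mono fun w hw => hw.2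
  refine ⟨htop, hfin.toFinset, fun z hz => ?_, fun z hz => ?_⟩
  · rw [Set.Finite.mem_toFinset] at hz
    refine lt_of_le_of_ne hz.1 fun h => hs z h hz.2
  · rw [Set.Finite.mem_toFinset]
    exact ⟨fun h => ⟨hz, h⟩, fun h => h.2⟩

/-- **Rouché's theorem** for discs. -/
theorem rouche (hR : 0 < R) (hf : AnalyticOnNhd ℂ f (Metric.closedBall c R))
    (hg : AnalyticOnNhd ℂ g (Metric.closedBall c R))
    (hfg : ∀ z ∈ Metric.sphere c R, ‖f z - g z‖ < ‖g z‖) {Zf Zg : Finset ℂ}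
    (hZf : ∀ z ∈ Zf, z ∈ Metric.ball c R) (hZg : ∀ z ∈ Zg, z ∈ Metric.ball c R)
    (hfZ : ∀ z ∈ Metric.closedBall c R, f z = 0 ↔ z ∈ Zf)
    (hgZ : ∀ z ∈ Metric.closedBall c R, g z = 0 ↔ z ∈ Zg) :
    ∑ z ∈ Zf, analyticOrderNatAt f z = ∑ z ∈ Zg, analyticOrderNatAt g z := by
  have hg0 : ∀ z ∈ Metric.sphere c R, g z ≠ 0 := fun z hz =>
    norm_pos_iff.1 ((norm_nonneg _).trans_lt (hfg z hz))
  have hf0 : ∀ z ∈ Metric.sphere c R, f z ≠ 0 := fun z hz h => by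
    have := hfg z hz
    rw [h, zero_sub, norm_neg] at this
    exact lt_irrefl _ this
  have hIf := circleIntegral_logDeriv hR hZf hf hfZ fun z hz =>
    (exists_finset_zeros hR hf hf0).1 z (Metric.ball_subset_closedBall (hZf z hz))
  have hIg := circleIntegral_logDeriv hR hZg hg hgZ fun z hz =>
    (exists_finset_zeros hR hg hg0).1 z (Metric.ball_subset_closedBall (hZg z hz))
  have hci : ∀ {h : ℂ → ℂ}, AnalyticOnNhd ℂ h (Metric.closedBall c R) →
      (∀ z ∈ Metric.sphere c R, h z ≠ 0) → CircleIntegrable (logDeriv h) c R := by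
    intro h hh h0
    refine ContinuousOn.circleIntegrable hR.le fun z hz => ?_
    have hhz := hh z (Metric.sphere_subset_closedBall hz)
    exact (hhz.deriv.div hhz (h0 z hz)).continuousAt.continuousWithinAt
  have hzero : ∮ z in C(c, R), (logDeriv f z - logDeriv g z) = 0 := by
    refine circleIntegral.integral_eq_zero_of_hasDerivWithinAt
      (f := fun z => Complex.log (f z / g z)) hR.le fun z hz => ?_
    have hzc := Metric.sphere_subset_closedBall hz
    have hslit : f z / g z ∈ Complex.slitPlane := by
      refine Complex.mem_slitPlane_of_norm_lt_one (z := f z / g z - 1) ?_ |> fun h => by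
        simpa using h
      rw [div_sub_one (hg0 z hz), norm_div, div_lt_one (norm_pos_iff.2 (hg0 z hz))]
      exact hfg z hz
    have hd := (((hf z hzc).differentiableAt.hasDerivAt.div
      (hg z hzc).differentiableAt.hasDerivAt (hg0 z hz)).clog hslit).hasDerivWithinAt
      (s := Metric.sphere c R)
    have h1 := hg0 z hz
    have h2 := hf0 z hz
    refine hd.congr_deriv ?_
    rw [logDeriv_apply, logDeriv_apply, Pi.div_apply]
    field_simp
  rw [circleIntegral.integral_sub (hci hf hf0) (hci hg hg0), hIf, hIg, sub_eq_zero] at hzero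
  have := mul_left_cancel₀ Complex.two_pi_I_ne_zero hzero
  exact_mod_cast this

end Rouche

section Asymptotics

variable {I : Type*} {lam : I → ℝ} {a : I → ℂ}

theorem exists_forall_norm_cauchySum_lt (ha : Summable a) {ε η : ℝ} (hε : 0 < ε) (hη : 0 < η) :
    ∃ r : ℝ, ∀ w : ℂ, r < ‖w‖ → (∀ n, ε ≤ ‖(lam n : ℂ) - w‖) → ‖cauchySum lam a w‖ < η := by
  let E : Set ℂ := {w | ∀ n, ε ≤ ‖(lam n : ℂ) - w‖}
  have hlim : Filter.Tendsto (cauchySum lam a) (Bornology.cobounded ℂ ⊓ Filter.principal E)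
      (nhds (∑' _ : I, 0)) := by
    refine tendsto_tsum_of_dominated_convergence (ha.norm.mul_right ε⁻¹) (fun n => ?_) ?_
    · refine Filter.Tendsto.mono_left ?_ inf_le_left
      have h1 : Filter.Tendsto (fun w : ℂ => (lam n : ℂ) - w) (Bornology.cobounded ℂ)
          (Bornology.cobounded ℂ) := by
        rw [← tendsto_norm_atTop_iff_cobounded]
        refine Filter.tendsto_atTop_mono (fun w => ?_)
          (Filter.tendsto_atTop_add_const_right _ (-‖(lam n : ℂ)‖) tendsto_norm_cobounded_atTop)
        have := norm_sub_norm_le w (lam n : ℂ)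
        rw [norm_sub_rev] at this
        linarith
      simpa [div_eq_mul_inv] using (Filter.tendsto_inv₀_cobounded.comp h1).const_mul (a n)
    · filter_upwards [Filter.mem_inf_of_right (Filter.mem_principal_self E)] with w hw n
      rw [norm_div, div_eq_mul_inv]
      gcongr
      exact hw n
  rw [tsum_zero] at hlim
  have h2 := (Metric.tendsto_nhds.1 hlim) η hη
  rw [Filter.eventually_inf_principal, Filter.hasBasis_cobounded_norm.eventually_iff] at h2
  obtain ⟨r, -, hr⟩ := h2
  exact ⟨r, fun w hw hE => by simpa using hr hw.le hE⟩

theorem exists_radius_forall_le_abs_sub {d : ℝ} (hd : 0 < d)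
    (hsep : ∀ m n : I, m ≠ n → d ≤ |lam m - lam n|) (R₀ : ℝ) :
    ∃ R, R₀ ≤ R ∧ ∀ n, d / 8 ≤ |(|lam n|) - R| := by
  by_contra! hcon
  obtain ⟨n₀, h0⟩ := hcon R₀ le_rfl
  obtain ⟨n₁, h1⟩ := hcon (R₀ + d / 4) (by linarith)
  obtain ⟨n₂, h2⟩ := hcon (R₀ + d / 2) (by linarith)
  rw [abs_lt] at h0 h1 h2
  have key : ∀ m n : I, |(|lam m|) - (|lam n|)| < d → (|lam m|) ≠ |lam n| →
      0 ≤ lam m → 0 ≤ lam n → False := fun m n h1 h2 hm hn => by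
    rw [abs_of_nonneg hm, abs_of_nonneg hn] at h1 h2
    have := hsep m n fun h => h2 (by rw [h])
    linarith
  have key' : ∀ m n : I, |(|lam m|) - (|lam n|)| < d → (|lam m|) ≠ |lam n| →
      lam m ≤ 0 → lam n ≤ 0 → False := fun m n h1 h2 hm hn => by
    rw [abs_of_nonpos hm, abs_of_nonpos hn] at h1 h2
    have := hsep m n fun h => h2 (by rw [h])
    rw [neg_sub_neg, abs_sub_comm] at h1
    linarith
  have h01 : |(|lam n₀|) - (|lam n₁|)| < d := by rw [abs_lt]; constructor <;> linarith
  have h02 : |(|lam n₀|) - (|lam n₂|)| < d := by rw [abs_lt]; constructor <;> linarith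
  have h12 : |(|lam n₁|) - (|lam n₂|)| < d := by rw [abs_lt]; constructor <;> linarith
  have g01 : (|lam n₀|) ≠ |lam n₁| := fun h => by linarith
  have g02 : (|lam n₀|) ≠ |lam n₂| := fun h => by linarith
  have g12 : (|lam n₁|) ≠ |lam n₂| := fun h => by linarith
  rcases le_total 0 (lam n₀) with s0 | s0 <;> rcases le_total 0 (lam n₁) with s1 | s1 <;>
    rcases le_total 0 (lam n₂) with s2 | s2 <;>
    first
    | exact key _ _ h01 g01 s0 s1
    | exact key _ _ h02 g02 s0 s2
    | exact key _ _ h12 g12 s1 s2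
    | exact key' _ _ h01 g01 s0 s1
    | exact key' _ _ h02 g02 s0 s2
    | exact key' _ _ h12 g12 s1 s2

end Asymptotics

section Counting

variable {H : Type*} [NormedAddCommGroup H] [InnerProductSpace ℂ H]
variable {I : Type*} {A : H →ₗ.[ℂ] H} {e : HilbertBasis I ℂ H} {lam : I → ℝ} {φ ψ : H}

theorem IsDiagonal.algMult_eq_zero_of_norm_lt (hA : IsDiagonal A e lam)
    (hsep : UniformlySeparated lam) {z : ℂ} (hz : ∀ n, (lam n : ℂ) ≠ z)
    (h : ‖cauchySum lam (residues e φ ψ) z‖ < 1) : algMult (perturb A φ ψ) z = 0 := by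
  obtain ⟨S, hS⟩ := hsep.exists_isReducedResolvent e z
  refine hA.algMult_eq_of_forall_ne hz hS (m := 0) (fun j hj => absurd hj (Nat.not_lt_zero j)) ?_
  rw [hS.taylorCoeff_eq, cauchyCoeff, if_pos rfl]
  simp only [zero_add, pow_one]
  intro h0
  have h1 : cauchySum lam (residues e φ ψ) z = -1 := eq_neg_of_add_eq_zero_left h0
  rw [h1] at h
  simp at h

theorem analyticOrderAt_prod_sub [DecidableEq I] (hlam : Function.Injective lam) {s : Finset I}
    {p : I} (hp : p ∈ s) : analyticOrderAt (fun w : ℂ => ∏ n ∈ s, (w - lam n)) (lam p) = 1 := by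
  have hprod : ∀ t : Finset I, AnalyticAt ℂ (fun w : ℂ => ∏ n ∈ t, (w - lam n)) (lam p) := fun t =>
    Finset.analyticAt_fun_prod _ fun n _ => analyticAt_id.sub analyticAt_const
  refine (hprod s).analyticOrderAt_eq_natCast.2 ⟨_, hprod (s.erase p), ?_, ?_⟩
  · refine Finset.prod_ne_zero_iff.2 fun n hn => sub_ne_zero.2 fun h => ?_
    exact Finset.ne_of_mem_erase hn (hlam (by exact_mod_cast h.symm))
  · refine Filter.Eventually.of_forall fun w => ?_
    rw [pow_one, smul_eq_mul, Finset.mul_prod_erase s (fun n => w - (lam n : ℂ)) hp]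

/-- A disc on whose boundary the perturbation is small contains as many eigenvalues of the
perturbed operator, counted with multiplicities, as it contains eigenvalues of `A`. -/
theorem IsDiagonal.exists_count (hA : IsDiagonal A e lam) (hlam : Function.Injective lam)
    (hsep : UniformlySeparated lam) {c : ℂ} {R : ℝ} (hR : 0 < R) {s : Finset I}
    (hs : ∀ n, n ∈ s ↔ ‖(lam n : ℂ) - c‖ < R) (hne : ∀ n, ‖(lam n : ℂ) - c‖ ≠ R)
    (hsmall : ∀ z ∈ Metric.sphere c R, ‖cauchySum lam (residues e φ ψ) z‖ < 1) :
    ∃ (Z : Finset ℂ) (mult : ℂ → ℕ), (∀ z ∈ Z, z ∈ Metric.ball c R) ∧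
      (∀ z ∈ Metric.ball c R, algMult (perturb A φ ψ) z = mult z) ∧
      (∀ z ∈ Metric.ball c R, z ∈ Z ↔ mult z ≠ 0) ∧ ∑ z ∈ Z, mult z = s.card := by
  classical
  set a := residues e φ ψ with hadef
  have ha : Summable a := summable_residues
  have hout : ∀ z ∈ Metric.closedBall c R, ∀ n ∉ s, (lam n : ℂ) ≠ z := by
    rintro _ hz n hn rfl
    rw [mem_closedBall_iff_norm] at hz
    exact hn ((hs n).2 (lt_of_le_of_ne hz (hne n)))
  have hh : AnalyticOnNhd ℂ (clearedSum lam a s) (Metric.closedBall c R) := fun z hz =>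
    hsep.analyticAt_clearedSum ha (hout z hz)
  have hP : AnalyticOnNhd ℂ (fun w : ℂ => ∏ n ∈ s, (w - lam n)) (Metric.closedBall c R) :=
    fun z _ => Finset.analyticAt_fun_prod _ fun n _ => analyticAt_id.sub analyticAt_const
  have hsph : ∀ z ∈ Metric.sphere c R, ∀ n, (lam n : ℂ) ≠ z := by
    rintro _ hz n rfl
    exact hne n (mem_sphere_iff_norm.1 hz)
  have hP0 : ∀ z ∈ Metric.sphere c R, ∏ n ∈ s, (z - (lam n : ℂ)) ≠ 0 := fun z hz =>
    Finset.prod_ne_zero_iff.2 fun n _ => sub_ne_zero.2 (hsph z hz n).symm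
  have hlt : ∀ z ∈ Metric.sphere c R,
      ‖clearedSum lam a s z - ∏ n ∈ s, (z - (lam n : ℂ))‖ < ‖∏ n ∈ s, (z - (lam n : ℂ))‖ := by
    intro z hz
    rw [hsep.clearedSum_eq ha fun n _ h => absurd h (hsph z hz n), mul_add, mul_one,
      add_sub_cancel_left, norm_mul]
    exact mul_lt_of_lt_one_right (norm_pos_iff.2 (hP0 z hz)) (hsmall z hz)
  have hh0 : ∀ z ∈ Metric.sphere c R, clearedSum lam a s z ≠ 0 := fun z hz h => by
    have := hlt z hz
    rw [h, zero_sub, norm_neg] at this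
    exact lt_irrefl _ this
  obtain ⟨htop, Z, hZ, hhZ⟩ := exists_finset_zeros hR hh hh0
  have hlamC : Function.Injective fun n => (lam n : ℂ) := fun m n h =>
    hlam (Complex.ofReal_injective h)
  have hrouche := rouche hR hh hP hlt hZ (Zg := s.image fun n => (lam n : ℂ)) (fun z hz => by
      obtain ⟨n, hn, rfl⟩ := Finset.mem_image.1 hz
      rw [mem_ball_iff_norm]
      exact (hs n).1 hn) hhZ (fun z _ => by
      rw [Finset.prod_eq_zero_iff, Finset.mem_image]
      simp only [sub_eq_zero, eq_comm])
  refine ⟨Z, analyticOrderNatAt (clearedSum lam a s), hZ, fun z hz => ?_, fun z hz => ?_, ?_⟩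
  · have hzc := Metric.ball_subset_closedBall hz
    rw [Nat.cast_analyticOrderNatAt (htop z hzc)]
    exact hA.algMult_eq_analyticOrderAt hlam hsep (hout z hzc) (htop z hzc)
  · have hzc := Metric.ball_subset_closedBall hz
    rw [← hhZ z hzc, ← (hh z hzc).analyticOrderAt_ne_zero,
      ← Nat.cast_analyticOrderNatAt (htop z hzc), Nat.cast_ne_zero]
  · rw [hrouche, Finset.sum_image hlamC.injOn, Finset.card_eq_sum_ones]
    refine Finset.sum_congr rfl fun n hn => ?_
    rw [analyticOrderNatAt, analyticOrderAt_prod_sub hlam hn]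
    rfl

theorem IsDiagonal.exists_near (hA : IsDiagonal A e lam) (hsep : UniformlySeparated lam)
    (φ ψ : H) {ε : ℝ} (hε : 0 < ε) :
    ∃ r : ℝ, ∀ z, algMult (perturb A φ ψ) z ≠ 0 → r < ‖z‖ → ∃ n, ‖z - (lam n : ℂ)‖ < ε := by
  obtain ⟨r, hr⟩ := exists_forall_norm_cauchySum_lt (lam := lam)
    (summable_residues (e := e) (φ := φ) (ψ := ψ)) hε one_pos
  refine ⟨r, fun z hz hrz => ?_⟩
  by_contra! hcon
  have hcon' : ∀ n, ε ≤ ‖(lam n : ℂ) - z‖ := fun n => norm_sub_rev z (lam n : ℂ) ▸ hcon n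
  refine hz (hA.algMult_eq_zero_of_norm_lt hsep (fun n h => ?_) (hr z hrz hcon'))
  have := hcon' n
  rw [h, sub_self, norm_zero] at this
  linarith

theorem IsDiagonal.exists_unique_near (hA : IsDiagonal A e lam) (hlam : Function.Injective lam)
    {d : ℝ} (hd : 0 < d) (hsep : ∀ m n : I, m ≠ n → d ≤ |lam m - lam n|)
    (φ ψ : H) {ε : ℝ} (hε : 0 < ε) (hεd : ε ≤ d / 2) :
    ∃ r : ℝ, ∀ n, r < |lam n| → ∃ z, ‖z - (lam n : ℂ)‖ < ε ∧ algMult (perturb A φ ψ) z = 1 ∧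
      ∀ z', ‖z' - (lam n : ℂ)‖ < ε → algMult (perturb A φ ψ) z' ≠ 0 → z' = z := by
  have hsep' : UniformlySeparated lam := ⟨d, hd, hsep⟩
  have hdist : ∀ m n, ‖(lam m : ℂ) - lam n‖ = |lam m - lam n| := fun m n => by
    rw [← Complex.ofReal_sub, Complex.norm_real, Real.norm_eq_abs]
  obtain ⟨r, hr⟩ := exists_forall_norm_cauchySum_lt (lam := lam)
    (summable_residues (e := e) (φ := φ) (ψ := ψ)) hε one_pos
  refine ⟨r + ε, fun n hn => ?_⟩
  have hball : ∀ m, m ∈ ({n} : Finset I) ↔ ‖(lam m : ℂ) - lam n‖ < ε := fun m => by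
    rw [Finset.mem_singleton]
    constructor
    · rintro rfl; simpa using hε
    · intro h
      by_contra hmn
      rw [hdist] at h
      linarith [hsep m n hmn]
  have hne : ∀ m, ‖(lam m : ℂ) - lam n‖ ≠ ε := fun m h => by
    by_cases hmn : m = n
    · rw [hmn, sub_self, norm_zero] at h
      linarith
    · rw [hdist] at h
      linarith [hsep m n hmn]
  obtain ⟨Z, mult, hZ, hmult, hZm, hsum⟩ := hA.exists_count (φ := φ) (ψ := ψ) hlam hsep' hε hball hne
    fun z hz => by
      rw [mem_sphere_iff_norm] at hz
      refine hr z ?_ fun m => ?_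
      · have := norm_sub_norm_le (lam n : ℂ) z
        rw [norm_sub_rev, hz, Complex.norm_real, Real.norm_eq_abs] at this
        linarith
      · by_cases hmn : m = n
        · rw [hmn, norm_sub_rev, hz]
        · have h1 := norm_sub_le ((lam m : ℂ) - z) (lam n - z)
          rw [sub_sub_sub_cancel_right, hdist, norm_sub_rev (lam n : ℂ) z, hz] at h1
          linarith [hsep m n hmn]
  rw [Finset.card_singleton] at hsum
  have hle : Z.card ≤ 1 := by
    rw [← hsum, Finset.card_eq_sum_ones]
    exact Finset.sum_le_sum fun z hz => Nat.one_le_iff_ne_zero.2 ((hZm z (hZ z hz)).1 hz)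
  have hZ1 : Z.card = 1 := by
    refine le_antisymm hle (Nat.one_le_iff_ne_zero.2 fun h => ?_)
    rw [Finset.card_eq_zero.1 h] at hsum
    simp at hsum
  obtain ⟨z, rfl⟩ := Finset.card_eq_one.1 hZ1
  have hzb := hZ z (Finset.mem_singleton_self z)
  refine ⟨z, mem_ball_iff_norm.1 hzb, ?_, fun z' hz' h => ?_⟩
  · rw [Finset.sum_singleton] at hsum
    rw [hmult z hzb, hsum, Nat.cast_one]
  · have hz'b := mem_ball_iff_norm.2 hz'
    rw [hmult z' hz'b, Nat.cast_ne_zero] at h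
    exact Finset.mem_singleton.1 ((hZm z' hz'b).2 h)

theorem IsDiagonal.eventually_near_and_simple (hA : IsDiagonal A e lam)
    (hlam : Function.Injective lam) (hsep : UniformlySeparated lam) (φ ψ : H) {ε : ℝ}
    (hε : 0 < ε) : ∃ r : ℝ, ∀ z : ℂ, algMult (perturb A φ ψ) z ≠ 0 → r < ‖z‖ →
      (∃ n, ‖z - (lam n : ℂ)‖ < ε) ∧ algMult (perturb A φ ψ) z = 1 := by
  have hsep' := hsep
  obtain ⟨d, hd, hsep⟩ := hsep
  set ρ := min ε (d / 2)
  have hρ : 0 < ρ := lt_min hε (by linarith)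
  obtain ⟨r₁, h1⟩ := hA.exists_near hsep' φ ψ hρ
  obtain ⟨r₂, h2⟩ := hA.exists_unique_near hlam hd hsep φ ψ hρ (min_le_right _ _)
  refine ⟨max r₁ (r₂ + ρ), fun z hz hrz => ?_⟩
  obtain ⟨n, hn⟩ := h1 z hz ((le_max_left _ _).trans_lt hrz)
  refine ⟨⟨n, hn.trans_le (min_le_left _ _)⟩, ?_⟩
  have h3 : r₂ < |lam n| := by
    have h4 := norm_sub_norm_le z (lam n : ℂ)
    rw [Complex.norm_real, Real.norm_eq_abs] at h4
    linarith [(le_max_right r₁ (r₂ + ρ)).trans_lt hrz]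
  obtain ⟨w, -, hw, hw'⟩ := h2 n h3
  rw [hw' z hn hz, hw]

/-- The eigenvalues of the perturbed operator, repeated according to multiplicity, can be
enumerated so that they are asymptotic to those of `A`. -/
theorem IsDiagonal.exists_enumeration (hA : IsDiagonal A e lam)
    (hlam : Function.Injective lam) (hsep : UniformlySeparated lam) (φ ψ : H) :
    ∃ mu : I → ℂ, (∀ z : ℂ, {n : I | mu n = z}.encard = algMult (perturb A φ ψ) z) ∧
      Filter.Tendsto (fun n : I => mu n - (lam n : ℂ)) Filter.cofinite (nhds 0) := by
  classical
  have hsep' := hsep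
  obtain ⟨d, hd, hsep⟩ := hsep
  set ρ := d / 8 with hρdef
  have hρ : 0 < ρ := by positivity
  have hdist : ∀ m n, ‖(lam m : ℂ) - lam n‖ = |lam m - lam n| := fun m n => by
    rw [← Complex.ofReal_sub, Complex.norm_real, Real.norm_eq_abs]
  have hclose : ∀ {m n : I} {z : ℂ}, ‖z - lam m‖ < ρ → ‖z - lam n‖ < ρ → m = n := by
    intro m n z hm hn
    by_contra hmn
    have h1 := norm_sub_le (z - (lam n : ℂ)) (z - lam m)
    rw [sub_sub_sub_cancel_left, hdist] at h1
    linarith [hsep m n hmn]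
  have hnorm : ∀ n, ‖(lam n : ℂ)‖ = |lam n| := fun n => by
    rw [Complex.norm_real, Real.norm_eq_abs]
  obtain ⟨r₁, h1⟩ := hA.exists_near hsep' φ ψ hρ
  obtain ⟨r₂, h2⟩ := hA.exists_unique_near hlam hd hsep φ ψ hρ (by linarith)
  obtain ⟨r₃, h3⟩ := exists_forall_norm_cauchySum_lt (lam := lam)
    (summable_residues (e := e) (φ := φ) (ψ := ψ)) hρ one_pos
  obtain ⟨R, hR₀, hRlam⟩ := exists_radius_forall_le_abs_sub hd hsep
    (max (max r₁ r₂) (max r₃ 0) + 1)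
  have hRr₁ : r₁ < R := by
    linarith [(le_max_left r₁ r₂).trans (le_max_left (max r₁ r₂) (max r₃ 0))]
  have hRr₂ : r₂ < R := by
    linarith [(le_max_right r₁ r₂).trans (le_max_left (max r₁ r₂) (max r₃ 0))]
  have hRr₃ : r₃ < R := by
    linarith [(le_max_left r₃ 0).trans (le_max_right (max r₁ r₂) (max r₃ 0))]
  have hR : 0 < R := by
    linarith [(le_max_right r₃ 0).trans (le_max_right (max r₁ r₂) (max r₃ 0))]
  have hfin : {n | ‖(lam n : ℂ) - 0‖ < R}.Finite :=
    (hsep'.finite_norm_sub_le 0 R).subset fun n (hn : _ < R) => hn.le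
  set s := hfin.toFinset
  have hs : ∀ n, n ∈ s ↔ ‖(lam n : ℂ) - 0‖ < R := fun n => hfin.mem_toFinset
  have hs' : ∀ n, n ∈ s ↔ |lam n| < R := fun n => by rw [hs, sub_zero, hnorm]
  have hout : ∀ n, n ∉ s → R + ρ ≤ |lam n| := fun n hn => by
    rw [hs', not_lt] at hn
    have := hRlam n
    rw [abs_of_nonneg (by linarith)] at this
    linarith
  obtain ⟨Z, mult, hZ, hmult, hZm, hsum⟩ := hA.exists_count (φ := φ) (ψ := ψ) hlam hsep' hR hs
    (fun n h => by
      have := hRlam n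
      rw [sub_zero, hnorm] at h
      rw [h, sub_self, abs_zero] at this
      linarith)
    (fun z hz => by
      rw [mem_sphere_iff_norm, sub_zero] at hz
      refine h3 z (by linarith) fun n => (hRlam n).trans ?_
      have := abs_norm_sub_norm_le (lam n : ℂ) z
      rwa [hnorm, hz] at this)
  have hν : ∀ n, ∃ z, n ∉ s → ‖z - (lam n : ℂ)‖ < ρ ∧ algMult (perturb A φ ψ) z = 1 ∧
      ∀ z', ‖z' - (lam n : ℂ)‖ < ρ → algMult (perturb A φ ψ) z' ≠ 0 → z' = z := fun n => by
    by_cases hn : n ∈ s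
    · exact ⟨0, fun h => absurd hn h⟩
    · obtain ⟨z, hz⟩ := h2 n (by linarith [hout n hn])
      exact ⟨z, fun _ => hz⟩
  choose ν hν using hν
  have hcard : Fintype.card s = Fintype.card (Σ z : Z, Fin (mult z)) := by
    rw [Fintype.card_coe, Fintype.card_sigma, ← hsum, ← Finset.sum_coe_sort Z mult]
    simp
  let E : s ≃ Σ z : Z, Fin (mult z) := Fintype.equivOfCardEq hcard
  let mu : I → ℂ := fun n => if h : n ∈ s then ((E ⟨n, h⟩).1 : ℂ) else ν n
  have hmu_in : ∀ n (h : n ∈ s), mu n = (E ⟨n, h⟩).1 := fun n h => dif_pos h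
  have hmu_out : ∀ n, n ∉ s → mu n = ν n := fun n h => dif_neg h
  have hin_lt : ∀ n ∈ s, ‖mu n‖ < R := fun n h => by
    rw [hmu_in n h]
    simpa using hZ _ (E ⟨n, h⟩).1.2
  have hout_gt : ∀ n ∉ s, R < ‖mu n‖ := fun n h => by
    have h4 := norm_sub_norm_le (lam n : ℂ) (ν n)
    rw [norm_sub_rev, hnorm] at h4
    rw [hmu_out n h]
    linarith [hout n h, (hν n h).1]
  refine ⟨mu, fun z => ?_, ?_⟩
  · rcases lt_or_ge ‖z‖ R with hzR | hzR
    · have hzb : z ∈ Metric.ball (0 : ℂ) R := by simpa using hzR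
      rw [hmult z hzb]
      have hmem : ∀ n, mu n = z → n ∈ s := fun n hn => by
        by_contra h
        have := hout_gt n h
        rw [hn] at this
        linarith
      by_cases hzZ : z ∈ Z
      · have hset : {n | mu n = z} =
            Set.range fun i : Fin (mult z) => ((E.symm ⟨⟨z, hzZ⟩, i⟩ : s) : I) := by
          ext n
          constructor
          · intro hn
            have hns := hmem n hn
            have h5 : (E ⟨n, hns⟩).1 = ⟨z, hzZ⟩ := Subtype.ext ((hmu_in n hns).symm.trans hn)
            rcases hE : E ⟨n, hns⟩ with ⟨z', i⟩
            rw [hE] at h5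
            simp only at h5
            subst h5
            exact ⟨i, by simp only [← hE, Equiv.symm_apply_apply]⟩
          · rintro ⟨i, rfl⟩
            simp only [Set.mem_ofPred_eq]
            rw [hmu_in _ (E.symm ⟨⟨z, hzZ⟩, i⟩).2]
            simp
        have hinj : Function.Injective
            fun i : Fin (mult z) => ((E.symm ⟨⟨z, hzZ⟩, i⟩ : s) : I) := fun i j hij => by
          have := E.symm.injective (Subtype.ext hij)
          simpa using this
        rw [hset, ← Set.image_univ, hinj.encard_image, Set.encard_univ]
        simp
      · have h0 : mult z = 0 := by
          by_contra h
          exact hzZ ((hZm z hzb).2 h)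
        rw [h0, Nat.cast_zero, Set.encard_eq_zero, Set.eq_empty_iff_forall_notMem]
        intro n hn
        have hns := hmem n hn
        rw [Set.mem_ofPred_eq, hmu_in n hns] at hn
        exact hzZ (hn ▸ (E ⟨n, hns⟩).1.2)
    · have hmem : ∀ n, mu n = z → n ∉ s := fun n hn h => by
        have := hin_lt n h
        rw [hn] at this
        linarith
      by_cases h0 : algMult (perturb A φ ψ) z = 0
      · rw [h0, Set.encard_eq_zero, Set.eq_empty_iff_forall_notMem]
        intro n hn
        have hns := hmem n hn
        rw [Set.mem_ofPred_eq, hmu_out n hns] at hn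
        have := (hν n hns).2.1
        rw [hn, h0] at this
        exact zero_ne_one this
      · obtain ⟨n, hn⟩ := h1 z h0 (by linarith)
        have hns : n ∉ s := fun h => by
          rw [hs'] at h
          have h4 := hRlam n
          rw [abs_of_neg (by linarith)] at h4
          have h5 := norm_sub_norm_le z (lam n : ℂ)
          rw [hnorm] at h5
          linarith
        have hz := (hν n hns).2.2 z hn h0
        have hset : {n | mu n = z} = {n} := by
          ext m
          rw [Set.mem_ofPred_eq, Set.mem_singleton_iff]
          constructor
          · intro hm
            have hms := hmem m hm
            rw [hmu_out m hms] at hm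
            have := (hν m hms).1
            rw [hm] at this
            exact hclose this hn
          · rintro rfl
            rw [hmu_out m hns, hz]
        rw [hset, Set.encard_singleton, hz, (hν n hns).2.1]
  · rw [Metric.tendsto_nhds]
    intro δ hδ
    obtain ⟨r, hr⟩ := hA.exists_near hsep' φ ψ (lt_min hδ hρ)
    rw [Filter.eventually_cofinite]
    refine (hsep'.finite_norm_sub_le 0 (max R (r + ρ))).subset fun n hn => ?_
    by_contra hlarge
    rw [Set.mem_ofPred_eq, sub_zero, hnorm, not_le] at hlarge
    apply hn
    have hns : n ∉ s := fun h => by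
      rw [hs'] at h
      linarith [le_max_left R (r + ρ)]
    obtain ⟨g1, g2, -⟩ := hν n hns
    have h4 := norm_sub_norm_le (lam n : ℂ) (ν n)
    rw [norm_sub_rev, hnorm] at h4
    obtain ⟨m, hm⟩ := hr (ν n) (by rw [g2]; exact one_ne_zero)
      (by linarith [le_max_right R (r + ρ)])
    have hmn := hclose (hm.trans_le (min_le_right _ _)) g1
    rw [dist_zero_right, hmu_out n hns, ← hmn]
    rw [hmn] at hm ⊢
    exact hm.trans_le (min_le_left _ _)

end Counting

section Prescribed

variable {H : Type*} [NormedAddCommGroup H] [InnerProductSpace ℂ H]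
variable {I : Type*} {A : H →ₗ.[ℂ] H} {e : HilbertBasis I ℂ H} {lam : I → ℝ}

theorem exists_sum_mul_prod_erase_eq [DecidableEq I] {v : I → ℂ} (hv : Function.Injective v)
    (s : Finset I) {q : Polynomial ℂ} (hq : q.Monic) (hdeg : q.natDegree = s.card) :
    ∃ a : I → ℂ, (∀ n ∈ s, q.eval (v n) ≠ 0 → a n ≠ 0) ∧
      ∀ w, (∏ n ∈ s, (w - v n)) - ∑ n ∈ s, a n * ∏ k ∈ s.erase n, (w - v k) = q.eval w := by
  set D : Polynomial ℂ := ∏ n ∈ s, (Polynomial.X - Polynomial.C (v n)) with hD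
  have hDm : D.Monic := Polynomial.monic_prod_of_monic _ _ fun n _ => Polynomial.monic_X_sub_C _
  have hDdeg : D.degree = s.card := by
    rw [Polynomial.degree_eq_natDegree hDm.ne_zero, hD, Polynomial.natDegree_prod_of_monic _ _
      fun n _ => Polynomial.monic_X_sub_C _]
    simp
  have hqdeg : q.degree = s.card := by rw [Polynomial.degree_eq_natDegree hq.ne_zero, hdeg]
  have hlt : (D - q).degree < s.card := by
    rw [← hDdeg]
    exact Polynomial.degree_sub_lt_left (hDdeg.trans hqdeg.symm) hDm.ne_zero
      (hDm.leadingCoeff.trans hq.leadingCoeff.symm)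
  have hDeval : ∀ w, D.eval w = ∏ n ∈ s, (w - v n) := fun w => by
    simp [hD, Polynomial.eval_prod]
  have hint := Lagrange.eq_interpolate (hv.injOn (s := (s : Set I))) hlt
  refine ⟨fun n => (D - q).eval (v n) * ∏ k ∈ s.erase n, (v n - v k)⁻¹, fun n hn h => ?_,
    fun w => ?_⟩
  · refine mul_ne_zero ?_ (Finset.prod_ne_zero_iff.2 fun k hk => inv_ne_zero (sub_ne_zero.2 ?_))
    · rw [Polynomial.eval_sub, hDeval, Finset.prod_eq_zero hn (sub_self _), zero_sub]
      exact neg_ne_zero.2 h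
    · exact fun h => Finset.ne_of_mem_erase hk (hv h.symm)
  · have h1 := congrArg (Polynomial.eval w) hint
    rw [Lagrange.interpolate_apply, Polynomial.eval_sub, hDeval, Polynomial.eval_finsetSum] at h1
    rw [sub_eq_iff_eq_add, ← sub_eq_iff_eq_add', h1]
    refine Finset.sum_congr rfl fun n _ => ?_
    rw [Polynomial.eval_mul, Polynomial.eval_C, mul_assoc, ← Finset.prod_mul_distrib,
      Lagrange.basis, Polynomial.eval_prod]
    congr 1
    refine Finset.prod_congr rfl fun k _ => ?_
    simp [Lagrange.basisDivisor]

theorem IsDiagonal.exists_prescribed [Infinite I] (hA : IsDiagonal A e lam)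
    (hlam : Function.Injective lam) (hsep : UniformlySeparated lam) {k : ℕ} (z : Fin k → ℂ)
    (m : Fin k → ℕ) (hz : Function.Injective z) (hm : ∀ j, 1 ≤ m j) :
    ∃ φ ψ : H, φ ≠ 0 ∧ ψ ≠ 0 ∧ ∀ j, algMult (perturb A φ ψ) (z j) = m j := by
  classical
  have hlamC : Function.Injective fun n => (lam n : ℂ) := fun m n h =>
    hlam (Complex.ofReal_injective h)
  have hfin : {n | ∃ j, (lam n : ℂ) = z j}.Finite := by
    refine ((Set.finite_range z).preimage hlamC.injOn).subset ?_
    rintro n ⟨j, hj⟩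
    exact ⟨j, hj.symm⟩
  set s₀ := hfin.toFinset with hs₀
  have hmem₀ : ∀ n, n ∈ s₀ ↔ ∃ j, (lam n : ℂ) = z j := fun n => hfin.mem_toFinset
  have hcard₀ : s₀.card ≤ k := by
    rw [← Finset.card_image_of_injective s₀ hlamC]
    refine (Finset.card_le_card (t := Finset.univ.image z) fun w hw => ?_).trans
      (Finset.card_image_le.trans (by simp))
    obtain ⟨n, hn, rfl⟩ := Finset.mem_image.1 hw
    obtain ⟨j, hj⟩ := (hmem₀ n).1 hn
    exact Finset.mem_image.2 ⟨j, Finset.mem_univ j, hj.symm⟩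
  have hkm : k ≤ ∑ j, m j := by
    calc k = ∑ _j : Fin k, 1 := by simp
      _ ≤ ∑ j, m j := Finset.sum_le_sum fun j _ => hm j
  obtain ⟨s, hs₀s, hs⟩ := Infinite.exists_superset_card_eq s₀ (∑ j, m j + 1) (by omega)
  obtain ⟨n₀, hn₀, hn₀'⟩ := Finset.exists_mem_notMem_of_card_lt_card (s := s₀) (t := s) (by omega)
  obtain ⟨w₀, hw₀⟩ := Infinite.exists_notMem_finset
    (Finset.univ.image z ∪ {(lam n₀ : ℂ)} : Finset ℂ)
  have hw₀z : ∀ j, z j ≠ w₀ := fun j h => hw₀ (by simp [← h])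
  have hw₀n : (lam n₀ : ℂ) ≠ w₀ := fun h => hw₀ (by simp [← h])
  set q : Polynomial ℂ := (∏ j, (Polynomial.X - Polynomial.C (z j)) ^ m j) *
    (Polynomial.X - Polynomial.C w₀) with hq
  have hmon : ∀ j ∈ Finset.univ, ((Polynomial.X - Polynomial.C (z j)) ^ m j).Monic := fun j _ =>
    (Polynomial.monic_X_sub_C _).pow _
  have hqm : q.Monic := (Polynomial.monic_prod_of_monic _ _ hmon).mul (Polynomial.monic_X_sub_C _)
  have hqdeg : q.natDegree = s.card := by
    rw [hq, (Polynomial.monic_prod_of_monic _ _ hmon).natDegree_mul (Polynomial.monic_X_sub_C _),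
      Polynomial.natDegree_prod_of_monic _ _ hmon, hs]
    simp
  have hqeval : ∀ w, q.eval w = (∏ j, (w - z j) ^ m j) * (w - w₀) := fun w => by
    simp [hq, Polynomial.eval_prod]
  obtain ⟨a, ha, hsum⟩ := exists_sum_mul_prod_erase_eq hlamC s hqm hqdeg
  set φ : H := ∑ n ∈ s, e n with hφ
  set ψ : H := ∑ n ∈ s, a n • e n with hψ
  have hφn : ∀ n, ⟪φ, e n⟫_ℂ = if n ∈ s then 1 else 0 := fun n => by
    rw [hφ, sum_inner]
    simp [inner_basis]
  have hψn : ∀ n, ⟪e n, ψ⟫_ℂ = if n ∈ s then a n else 0 := fun n => by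
    rw [hψ, inner_sum]
    simp [inner_smul_right, inner_basis]
  have han₀ : a n₀ ≠ 0 := by
    refine ha n₀ hn₀ ?_
    rw [hqeval]
    refine mul_ne_zero (Finset.prod_ne_zero_iff.2 fun j _ => pow_ne_zero _ (sub_ne_zero.2 ?_))
      (sub_ne_zero.2 hw₀n)
    exact fun h => hn₀' ((hmem₀ n₀).2 ⟨j, h⟩)
  refine ⟨φ, ψ, fun h => ?_, fun h => ?_, fun j => ?_⟩
  · have := hφn n₀
    rw [h, if_pos hn₀, inner_zero_left] at this
    exact zero_ne_one this
  · have := hψn n₀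
    rw [h, if_pos hn₀, inner_zero_right] at this
    exact han₀ this.symm
  have hcl : clearedSum lam (residues e φ ψ) s = fun w => q.eval w := by
    funext w
    have h1 : (fun n => if n ∈ s then 0 else residues e φ ψ n) = fun _ => 0 := by
      funext n
      by_cases hn : n ∈ s
      · rw [if_pos hn]
      · rw [if_neg hn, residues, hφn, if_neg hn, zero_mul]
    rw [clearedSum, h1, ← hsum w]
    simp only [cauchySum, zero_div, tsum_zero, add_zero, mul_one]
    congr 1
    refine Finset.sum_congr rfl fun n hn => ?_
    rw [residues, hφn, hψn, if_pos hn, if_pos hn, one_mul]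
  have hord : analyticOrderAt (clearedSum lam (residues e φ ψ) s) (z j) = m j := by
    have hprod : ∀ t : Finset (Fin k), AnalyticAt ℂ (fun w : ℂ => ∏ i ∈ t, (w - z i) ^ m i) (z j) :=
      fun t => Finset.analyticAt_fun_prod _ fun i _ => (analyticAt_id.sub analyticAt_const).pow _
    have hlin : AnalyticAt ℂ (fun w : ℂ => w - w₀) (z j) := analyticAt_id.sub analyticAt_const
    rw [hcl]
    simp only [hqeval]
    refine ((hprod _).mul hlin).analyticOrderAt_eq_natCast.2
      ⟨_, (hprod (Finset.univ.erase j)).mul hlin, mul_ne_zero ?_ (sub_ne_zero.2 (hw₀z j)), ?_⟩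
    · refine Finset.prod_ne_zero_iff.2 fun i hi => pow_ne_zero _ (sub_ne_zero.2 fun h => ?_)
      exact Finset.ne_of_mem_erase hi (hz h.symm)
    · refine Filter.Eventually.of_forall fun w => ?_
      simp only [Pi.mul_apply, smul_eq_mul]
      rw [← mul_assoc, Finset.mul_prod_erase _ (fun i => (w - z i) ^ m i) (Finset.mem_univ j)]
  rw [← hord]
  refine hA.algMult_eq_analyticOrderAt hlam hsep (fun n hn h => ?_) ?_
  · exact hn (hs₀s ((hmem₀ n).2 ⟨j, h⟩))
  · rw [hord]; exact ENat.natCast_ne_top _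

theorem infinite_of_not_finiteDimensional (e : HilbertBasis I ℂ H)
    (hdim : ¬ FiniteDimensional ℂ H) : Infinite I := by
  by_contra h
  have : Finite I := not_infinite_iff_finite.1 h
  have := Fintype.ofFinite I
  exact hdim (Module.Basis.finiteDimensional_of_finite e.toOrthonormalBasis.toBasis)

end Prescribed

end RankOnePerturbation

theorem theorem1 {H : Type*} [NormedAddCommGroup H] [InnerProductSpace ℂ H] [CompleteSpace H]
    [TopologicalSpace.SeparableSpace H] (hdim : ¬ FiniteDimensional ℂ H)
    (A : H →ₗ.[ℂ] H) (hA : RankOnePerturbation.IsSelfAdjointSimpleDiscrete A)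
    {I : Type*} (lam : I → ℝ) (hlam : RankOnePerturbation.EnumeratesEigenvalues A lam)
    (hsep : ∃ d : ℝ, 0 < d ∧ ∀ m n : I, m ≠ n → d ≤ |lam m - lam n|) :
    (∀ φ ψ : H, φ ≠ 0 → ψ ≠ 0 →
      -- large eigenvalues are close to those of `A`, and simple
      (∀ ε : ℝ, 0 < ε → ∃ r : ℝ, ∀ z : ℂ,
        RankOnePerturbation.IsEigenvalue (RankOnePerturbation.perturb A φ ψ) z → r < ‖z‖ →
          (∃ n : I, ‖z - (lam n : ℂ)‖ < ε) ∧
            RankOnePerturbation.algMult (RankOnePerturbation.perturb A φ ψ) z = 1) ∧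
      -- enumeration of the eigenvalues, repeated according to algebraic multiplicity
      (∃ mu : I → ℂ,
        (∀ z : ℂ, {n : I | mu n = z}.encard =
          RankOnePerturbation.algMult (RankOnePerturbation.perturb A φ ψ) z) ∧
        Filter.Tendsto (fun n : I => mu n - (lam n : ℂ)) Filter.cofinite (nhds 0)) ∧
      -- geometric multiplicities
      (∀ z : ℂ, RankOnePerturbation.IsEigenvalue (RankOnePerturbation.perturb A φ ψ) z →
        RankOnePerturbation.geomMult (RankOnePerturbation.perturb A φ ψ) z ≤ 2 ∧
          (RankOnePerturbation.geomMult (RankOnePerturbation.perturb A φ ψ) z = 2 →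
            RankOnePerturbation.IsEigenvalue A z ∧
              RankOnePerturbation.Reduces (RankOnePerturbation.eigenspace A z)
                (RankOnePerturbation.perturb A φ ψ)))) ∧
    -- prescribed eigenvalues with prescribed algebraic multiplicities
    (∀ (k : ℕ) (z : Fin k → ℂ) (m : Fin k → ℕ), Function.Injective z → (∀ j, 1 ≤ m j) →
      ∃ φ ψ : H, φ ≠ 0 ∧ ψ ≠ 0 ∧ ∀ j : Fin k,
        RankOnePerturbation.IsEigenvalue (RankOnePerturbation.perturb A φ ψ) (z j) ∧
          RankOnePerturbation.algMult (RankOnePerturbation.perturb A φ ψ) (z j) = m j) := by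
  have hsep' : RankOnePerturbation.UniformlySeparated lam := hsep
  obtain ⟨e, he⟩ := RankOnePerturbation.exists_hilbertBasis_isDiagonal hA hlam hsep
  have : Infinite I := RankOnePerturbation.infinite_of_not_finiteDimensional e hdim
  refine ⟨fun φ ψ _ _ => ⟨fun ε hε => ?_, he.exists_enumeration hlam.injective hsep' φ ψ,
    fun z _ => he.geomMult_perturb hlam.injective⟩, fun k z m hz hm => ?_⟩
  · obtain ⟨r, hr⟩ := he.eventually_near_and_simple hlam.injective hsep' φ ψ hε
    exact ⟨r, fun z hz => hr z (RankOnePerturbation.algMult_ne_zero_of_isEigenvalue hz)⟩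
  · obtain ⟨φ, ψ, hφ, hψ, h⟩ := he.exists_prescribed hlam.injective hsep' z m hz hm
    refine ⟨φ, ψ, hφ, hψ, fun j => ⟨RankOnePerturbation.isEigenvalue_of_algMult_ne_zero ?_, h j⟩⟩
    rw [h j, Nat.cast_ne_zero]
    exact Nat.one_le_iff_ne_zero.1 (hm j)
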